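/- Let $n\ge 1$. The staircase of order $n$ consists of the boxes $(i,j)$ with $i,j\ge 1$ and $i+j\le n$, where the row index $i$ increases from top to bottom and the column index $j$ from left to right. A pipe dream of order $n$ places in each box either a cross (a pipe goes straight through) or a bump (a pipe entering from the left leaves through the top, and a pipe entering from the bottom leaves to the right); the positions with $i+j=n+1$ carry half bumps, which turn a pipe coming from the left upwards. For $i=1,\dots,n$, pipe $i$ enters row $i$ from the left, follows the tiles without any reduction, and leaves through the top of some column, denoted $w^{-1}(i)$; this defines a permutation $w\in S_n$. Fix $p\in[0,1)$, and let $\mathbf w(n)\in S_n$ be the random permutation obtained in this way when the tiles are chosen independently, each being a cross with probability $p$ and a bump with probability $1-p$. Let $\operatorname{inv}(w)=\#\{i<j : w(i)>w(j)\}$. Then for every $\varepsilon>0$ and all sufficiently large $n$ (depending on $p$ and $\varepsilon$), $$\frac{2}{3\sqrt\pi}(1-\varepsilon)\,n^{3/2}\sqrt{\frac{p}{1-p}}\;\le\;\mathbb E\bigl[\operatorname{inv}(\mathbf w(n))\bigr]\;\le\;\frac{4}{3\sqrt\pi}(1+\varepsilon)\,n^{3/2}\sqrt{\frac{p}{1-p}}.$$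 Moreover, as $n\to\infty$, the random permutations $\mathbf w(n)$ converge in distribution to the identity permuton. Here a permuton is a Borel probability measure on $[0,1]^2$ with uniform marginals, the space of permutons carries the topology of weak convergence, a permutation $w\in S_n$ is identified with the permuton of density $n$ on $\bigcup_{i=1}^n\bigl[\tfrac{i-1}{n},\tfrac in\bigr]\times\bigl[\tfrac{w(i)-1}{n},\tfrac{w(i)}n\bigr]$, and the identity permuton is the uniform measure on the diagonal of $[0,1]^2$. -/

import Mathlib

open MeasureTheory ProbabilityTheory Filter Topology
open scoped unitInterval ENNReal

namespace RandomPipeDream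

/-! ### Pipe dreams and the permutation read from one -/

/-- The two kinds of tiles. -/
inductive Tile where
  | cross
  | bump
  deriving DecidableEq

instance : Fintype Tile :=
  ⟨{Tile.cross, Tile.bump}, fun x => by cases x <;> simp⟩

instance : MeasurableSpace Tile := ⊤

instance : MeasurableSingletonClass Tile := ⟨fun _ => trivial⟩

/-- The boxes of the staircase shape of order `n`: box `(i, j)` is in row `i` (counted from the
top) and column `j` (counted from the left), both starting from `1`, and `i + j ≤ n`. -/
def staircase (n : ℕ) : Finset (ℕ × ℕ) :=
  (Finset.Icc 1 n ×ˢ Finset.Icc 1 n).filter (fun b => b.1 + b.2 ≤ n)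

theorem mem_staircase {n i j : ℕ} :
    (i, j) ∈ staircase n ↔ 1 ≤ i ∧ 1 ≤ j ∧ i + j ≤ n := by
  simp only [staircase, Finset.mem_filter, Finset.mem_product, Finset.mem_Icc]
  omega

/-- A pipe dream of order `n`: a tile in each box of the staircase shape. -/
abbrev PipeDream (n : ℕ) : Type := staircase n → Tile

/-- The tile of `D` at `(i, j)`. The positions on the diagonal `i + j = n + 1` carry half bumps,
which turn a pipe coming from the left upwards; pipes never get beyond this diagonal. -/
def tileAt {n : ℕ} (D : PipeDream n) (i j : ℕ) : Tile :=
  if h : (i, j) ∈ staircase n then D ⟨(i, j), h⟩ else Tile.bump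

/-- The side through which a pipe enters a box. -/
inductive Side where
  | left
  | bottom
  deriving DecidableEq

/-- A position of a pipe: it is about to enter the box `(row, col)` through the side `side`.
When `row = 0`, the pipe has left the staircase through the top of column `col`. -/
@[ext] structure Position where
  row : ℕ
  col : ℕ
  side : Side
  deriving DecidableEq

/-- The next position of a pipe. At a cross it goes straight (left to right, or bottom to top);
at a bump it turns (from the left upwards, or from the bottom to the right). A pipe that has left
the staircase stays where it is. -/
def step {n : ℕ} (D : PipeDream n) (s : Position) : Position :=
  if s.row = 0 then s else
    match tileAt D s.row s.col, s.side with
    | Tile.cross, Side.left => ⟨s.row, s.col + 1, Side.left⟩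
    | Tile.cross, Side.bottom => ⟨s.row - 1, s.col, Side.bottom⟩
    | Tile.bump, Side.left => ⟨s.row - 1, s.col, Side.bottom⟩
    | Tile.bump, Side.bottom => ⟨s.row, s.col + 1, Side.left⟩

/-- Pipe `i` starts at the left end of row `i`. -/
def start (i : ℕ) : Position := ⟨i, 1, Side.left⟩

/-- The column through whose top pipe `i` leaves the staircase. A pipe makes fewer than `2 * n`
steps before it leaves (`row_iterate_step`). -/
def exitColumn {n : ℕ} (D : PipeDream n) (i : ℕ) : ℕ :=
  ((step D)^[2 * n] (start i)).col

/-- The positions that pipes can reach. -/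
def Valid (n : ℕ) (s : Position) : Prop :=
  1 ≤ s.col ∧
    ((s.side = Side.left ∧ 1 ≤ s.row ∧ s.row + s.col ≤ n + 1) ∨
      (s.side = Side.bottom ∧ s.row + s.col ≤ n))

theorem tileAt_eq_cross {n : ℕ} {D : PipeDream n} {i j : ℕ} (h : tileAt D i j = Tile.cross) :
    i + j ≤ n := by
  unfold tileAt at h
  split_ifs at h with h'
  exact (mem_staircase.1 h').2.2

theorem Valid.step {n : ℕ} (D : PipeDream n) {s : Position} (hs : Valid n s) :
    Valid n (step D s) := by
  obtain ⟨r, c, d⟩ := s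
  unfold RandomPipeDream.step
  by_cases hr : r = 0
  · simpa [hr] using hs
  · simp only [hr, if_false]
    cases ht : tileAt D r c <;> cases d <;> simp [Valid] at hs ⊢
    · have := tileAt_eq_cross ht
      omega
    all_goals omega

theorem Valid.iterate {n : ℕ} (D : PipeDream n) {s : Position} (hs : Valid n s) (k : ℕ) :
    Valid n ((RandomPipeDream.step D)^[k] s) := by
  induction k with
  | zero => exact hs
  | succ k ih => rw [Function.iterate_succ_apply']; exact ih.step D

theorem valid_start {n i : ℕ} (h1 : 1 ≤ i) (hn : i ≤ n) : Valid n (start i) := by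
  simp [Valid, start]
  omega

theorem step_of_row_eq_zero {n : ℕ} (D : PipeDream n) {s : Position} (h : s.row = 0) :
    step D s = s := by
  simp [step, h]

theorem iterate_of_row_eq_zero {n : ℕ} (D : PipeDream n) {s : Position} (h : s.row = 0) (k : ℕ) :
    (step D)^[k] s = s :=
  Function.iterate_fixed (step_of_row_eq_zero D h) k

theorem step_potential {n : ℕ} (D : PipeDream n) {s : Position} (h : s.row ≠ 0) :
    (step D s).col + s.row = s.col + (step D s).row + 1 := by
  obtain ⟨r, c, d⟩ := s
  simp only at h
  unfold step
  simp only [h, if_false]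
  cases tileAt D r c <;> cases d <;> simp <;> omega

theorem iterate_potential {n : ℕ} (D : PipeDream n) (s : Position) (k : ℕ)
    (h : ((step D)^[k] s).row ≠ 0) :
    ((step D)^[k] s).col + s.row = s.col + ((step D)^[k] s).row + k := by
  induction k with
  | zero => simp
  | succ k ih =>
    rw [Function.iterate_succ_apply'] at h ⊢
    have h' : ((step D)^[k] s).row ≠ 0 := by
      intro h0
      rw [step_of_row_eq_zero D h0] at h
      exact h h0
    have := step_potential D h'
    have := ih h'
    omega

theorem row_iterate_step {n i : ℕ} (D : PipeDream n) (h1 : 1 ≤ i) (hn : i ≤ n) :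
    ((step D)^[2 * n] (start i)).row = 0 := by
  by_contra h
  have hp := iterate_potential D (start i) (2 * n) h
  have hv := (valid_start h1 hn).iterate D (2 * n)
  simp only [start] at hp hv
  unfold Valid at hv
  omega

theorem exitColumn_mem {n i : ℕ} (D : PipeDream n) (h1 : 1 ≤ i) (hn : i ≤ n) :
    1 ≤ exitColumn D i ∧ exitColumn D i ≤ n := by
  have hv := (valid_start h1 hn).iterate D (2 * n)
  have hr := row_iterate_step D h1 hn
  unfold Valid at hv
  unfold exitColumn
  omega

theorem step_injective {n : ℕ} (D : PipeDream n) {s t : Position} (hs : s.row ≠ 0)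
    (ht : t.row ≠ 0) (h : step D s = step D t) : s = t := by
  obtain ⟨r, c, d⟩ := s
  obtain ⟨r', c', d'⟩ := t
  simp only at hs ht
  unfold step at h
  simp only [hs, ht, if_false] at h
  have key : r = r' ∧ c = c' := by
    cases h1 : tileAt D r c <;> cases d <;> cases h2 : tileAt D r' c' <;> cases d' <;>
      simp_all <;> omega
  obtain ⟨rfl, rfl⟩ := key
  cases h1 : tileAt D r c <;> cases d <;> cases d' <;> simp_all

theorem iterate_back {n : ℕ} (D : PipeDream n) (s t : Position) (k : ℕ) :
    ∀ m, (∀ j < k, ((step D)^[j] s).row ≠ 0) → (∀ j < m + k, ((step D)^[j] t).row ≠ 0) →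
      (step D)^[k] s = (step D)^[m + k] t → s = (step D)^[m] t := by
  induction k with
  | zero => intro m _ _ h; simpa using h
  | succ k ih =>
    intro m hs ht h
    refine ih m (fun j hj => hs j (by omega)) (fun j hj => ht j (by omega)) ?_
    rw [← add_assoc, Function.iterate_succ_apply', Function.iterate_succ_apply'] at h
    exact step_injective D (hs k (by omega)) (ht (m + k) (by omega)) h

theorem step_ne_start {n : ℕ} (D : PipeDream n) {s : Position} (hs : 1 ≤ s.col)
    (hr : s.row ≠ 0) (i : ℕ) : step D s ≠ start i := by
  obtain ⟨r, c, d⟩ := s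
  simp only at hs hr
  unfold step start
  simp only [hr, if_false]
  cases tileAt D r c <;> cases d <;> simp <;> omega

/-- Distinct pipes leave the staircase through distinct columns. -/
theorem exitColumn_injOn {n i i' : ℕ} (D : PipeDream n) (h1 : 1 ≤ i) (hn : i ≤ n)
    (h1' : 1 ≤ i') (hn' : i' ≤ n) (h : exitColumn D i = exitColumn D i') : i = i' := by
  have hex := row_iterate_step D h1 hn
  have hex' := row_iterate_step D h1' hn'
  have hend : (step D)^[2 * n] (start i) = (step D)^[2 * n] (start i') := by
    have hv := (valid_start h1 hn).iterate D (2 * n)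
    have hv' := (valid_start h1' hn').iterate D (2 * n)
    have hb : ((step D)^[2 * n] (start i)).side = Side.bottom := by
      rcases hv.2 with hh | hh
      · omega
      · exact hh.1
    have hb' : ((step D)^[2 * n] (start i')).side = Side.bottom := by
      rcases hv'.2 with hh | hh
      · omega
      · exact hh.1
    exact Position.ext (hex.trans hex'.symm) h (hb.trans hb'.symm)
  have main : ∀ a b : ℕ, 1 ≤ a → a ≤ n → 1 ≤ b → b ≤ n →
      ∀ ha : ∃ k, ((step D)^[k] (start a)).row = 0, ∀ hb : ∃ k, ((step D)^[k] (start b)).row = 0,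
      Nat.find ha ≤ Nat.find hb →
      (step D)^[2 * n] (start a) = (step D)^[2 * n] (start b) →
      ((step D)^[2 * n] (start a)).row = 0 → ((step D)^[2 * n] (start b)).row = 0 → a = b := by
    intro a b ha1 han hb1 hbn ha hb hle heq hra hrb
    have hka : (step D)^[Nat.find ha] (start a) = (step D)^[2 * n] (start a) := by
      obtain ⟨d, hd⟩ := Nat.exists_eq_add_of_le' (Nat.find_min' ha hra)
      rw [hd, Function.iterate_add_apply, iterate_of_row_eq_zero D (Nat.find_spec ha)]
    have hkb : (step D)^[Nat.find hb] (start b) = (step D)^[2 * n] (start b) := by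
      obtain ⟨d, hd⟩ := Nat.exists_eq_add_of_le' (Nat.find_min' hb hrb)
      rw [hd, Function.iterate_add_apply, iterate_of_row_eq_zero D (Nat.find_spec hb)]
    obtain ⟨m, hm⟩ := Nat.exists_eq_add_of_le' hle
    have hback := iterate_back D (start a) (start b) (Nat.find ha) m
      (fun j hj => Nat.find_min ha hj) (fun j hj => Nat.find_min hb (by omega))
      (by rw [← hm, hka, hkb, heq])
    cases m with
    | zero => simpa [start] using hback
    | succ m =>
      rw [Function.iterate_succ_apply'] at hback
      have hpos : 0 < Nat.find ha := by
        rcases Nat.eq_zero_or_pos (Nat.find ha) with h0 | h0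
        · have := Nat.find_spec ha
          rw [h0] at this
          simp [start] at this
          omega
        · exact h0
      exact absurd hback.symm (step_ne_start D ((valid_start hb1 hbn).iterate D m).1
        (Nat.find_min hb (by omega)) a)
  have ha : ∃ k, ((step D)^[k] (start i)).row = 0 := ⟨2 * n, hex⟩
  have hb : ∃ k, ((step D)^[k] (start i')).row = 0 := ⟨2 * n, hex'⟩
  rcases le_total (Nat.find ha) (Nat.find hb) with hle | hle
  · exact main i i' h1 hn h1' hn' ha hb hle hend hex hex'
  · exact (main i' i h1' hn' h1 hn hb ha hle hend.symm hex' hex).symm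

/-- The map sending each pipe to its exit column, with pipes and columns numbered from `0`. -/
def exitMap {n : ℕ} (D : PipeDream n) (i : Fin n) : Fin n :=
  ⟨exitColumn D (i + 1) - 1, by
    have := exitColumn_mem D (i := i + 1) (by omega) (by omega)
    omega⟩

theorem exitMap_bijective {n : ℕ} (D : PipeDream n) : Function.Bijective (exitMap D) := by
  refine Finite.injective_iff_bijective.1 fun i i' h => ?_
  have h0 := congrArg Fin.val h
  simp only [exitMap] at h0
  have ha := exitColumn_mem D (i := i + 1) (by omega) (by omega)
  have hb := exitColumn_mem D (i := i' + 1) (by omega) (by omega)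
  have := exitColumn_injOn D (i := i + 1) (i' := i' + 1) (by omega) (by omega) (by omega)
    (by omega) (by omega)
  exact Fin.ext (by omega)

/-- The permutation `w` read from a pipe dream without any reduction: `w⁻¹ i` is the column
through which pipe `i` exits, that is, `w j` is the pipe which exits through column `j`. -/
noncomputable def perm {n : ℕ} (D : PipeDream n) : Equiv.Perm (Fin n) :=
  (Equiv.ofBijective (exitMap D) (exitMap_bijective D))⁻¹

/-- The number of inversions of a permutation. -/
def inv {n : ℕ} (w : Equiv.Perm (Fin n)) : ℕ :=
  (Finset.univ.filter (fun a : Fin n × Fin n => a.1 < a.2 ∧ w a.2 < w a.1)).card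

/-- The law of the random pipe dream of order `n`: the tiles are independent, and each one is a
cross with probability `p` and a bump with probability `1 - p`. -/
noncomputable def law (p : I) (n : ℕ) : Measure (PipeDream n) :=
  Measure.pi fun _ => bernoulliMeasure Tile.cross Tile.bump p

instance (p : I) (n : ℕ) : IsProbabilityMeasure (law p n) := by
  unfold law
  infer_instance

/-! ### Permutons -/

/-- A permuton: a Borel probability measure on the unit square with uniform marginals. -/
def Permuton : Type :=
  {μ : ProbabilityMeasure (I × I) //
    (μ : Measure (I × I)).map Prod.fst = volume ∧ (μ : Measure (I × I)).map Prod.snd = volume}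

/-- The topology of weak convergence of measures. -/
noncomputable instance : TopologicalSpace Permuton := instTopologicalSpaceSubtype

noncomputable instance : MeasurableSpace Permuton := borel Permuton

instance : BorelSpace Permuton := ⟨rfl⟩

/-- The identity permuton: the uniform measure on the diagonal of the unit square. -/
noncomputable def idPermuton : Permuton :=
  ⟨⟨(volume : Measure I).map (fun x => (x, x)),
      Measure.isProbabilityMeasure_map (by fun_prop)⟩, by
    constructor
    · change ((volume : Measure I).map (fun x => (x, x))).map Prod.fst = volume
      rw [Measure.map_map (by fun_prop) (by fun_prop)]
      exact Measure.map_id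
    · change ((volume : Measure I).map (fun x => (x, x))).map Prod.snd = volume
      rw [Measure.map_map (by fun_prop) (by fun_prop)]
      exact Measure.map_id⟩

/-- The `i`-th of the `n` intervals `[i/n, (i+1)/n)`, with `i` starting from `0`. -/
def cell {n : ℕ} (i : Fin n) : Set I :=
  {x | (i : ℝ) / n ≤ (x : ℝ) ∧ (x : ℝ) < ((i : ℝ) + 1) / n}

theorem measurableSet_cell {n : ℕ} (i : Fin n) : MeasurableSet (cell i) :=
  (measurableSet_le measurable_const measurable_subtype_coe).inter
    (measurableSet_lt measurable_subtype_coe measurable_const)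

theorem volume_cell {n : ℕ} (i : Fin n) : volume (cell i) = (n : ℝ≥0∞)⁻¹ := by
  have hn : (0 : ℝ) < n := by exact_mod_cast i.pos
  have hi : (i : ℝ) + 1 ≤ n := by exact_mod_cast i.isLt
  have h : (Subtype.val '' cell i : Set ℝ) = Set.Ico ((i : ℝ) / n) (((i : ℝ) + 1) / n) := by
    ext x
    constructor
    · rintro ⟨y, hy, rfl⟩
      exact hy
    · intro hx
      have h0 : (0 : ℝ) ≤ (i : ℝ) / n := by positivity
      have h1 : ((i : ℝ) + 1) / n ≤ 1 := by rw [div_le_one hn]; exact hi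
      exact ⟨⟨x, h0.trans hx.1, hx.2.le.trans h1⟩, hx, rfl⟩
  rw [unitInterval.volume_apply, h, Real.volume_Ico, ← ENNReal.ofReal_natCast n,
    ← ENNReal.ofReal_inv_of_pos hn]
  congr 1
  field_simp
  ring

theorem sum_restrict_cell (n : ℕ) [NeZero n] :
    ∑ i : Fin n, (volume : Measure I).restrict (cell i) = volume := by
  have hn : (0 : ℝ) < n := by exact_mod_cast Nat.pos_of_ne_zero (NeZero.ne n)
  have hd : Pairwise (Function.onFun Disjoint (fun i : Fin n => cell i)) := by
    intro i j hij
    refine Set.disjoint_left.2 fun x hx hy => hij ?_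
    have h1 := hx.1.trans_lt hy.2
    have h2 := hy.1.trans_lt hx.2
    rw [div_lt_div_iff_of_pos_right hn] at h1 h2
    have h1' : (i : ℕ) < j + 1 := by exact_mod_cast h1
    have h2' : (j : ℕ) < i + 1 := by exact_mod_cast h2
    exact Fin.ext (by omega)
  rw [← Measure.sum_fintype, ← Measure.restrict_iUnion hd measurableSet_cell]
  refine Measure.restrict_eq_self_of_ae_mem ?_
  have h1 : ∀ᵐ x : I, x ≠ 1 := by
    simp [ae_iff]
  filter_upwards [h1] with x hx
  have hx1 : (x : ℝ) < 1 := unitInterval.lt_one_iff_ne_one.2 hx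
  have hx0 : (0 : ℝ) ≤ n * (x : ℝ) := mul_nonneg hn.le x.2.1
  have hlt : ⌊(n : ℝ) * x⌋₊ < n := by
    rw [Nat.floor_lt hx0]
    nlinarith
  refine Set.mem_iUnion.2 ⟨⟨⌊(n : ℝ) * x⌋₊, hlt⟩, ?_, ?_⟩
  · rw [div_le_iff₀ hn, mul_comm (x : ℝ)]
    exact Nat.floor_le hx0
  · rw [lt_div_iff₀ hn, mul_comm (x : ℝ)]
    exact Nat.lt_floor_add_one _

/-- The measure on the unit square associated with a permutation `w` of size `n`: it has density
`n` on the union of the squares of side `1 / n` in the positions `(i, w i)`. -/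
noncomputable def permMeasure {n : ℕ} (w : Equiv.Perm (Fin n)) : Measure (I × I) :=
  ∑ i : Fin n, (n : ℝ≥0∞) • (volume : Measure (I × I)).restrict (cell i ×ˢ cell (w i))

theorem permMeasure_eq {n : ℕ} (w : Equiv.Perm (Fin n)) :
    permMeasure w = ∑ i : Fin n, (n : ℝ≥0∞) •
      ((volume : Measure I).restrict (cell i)).prod
        ((volume : Measure I).restrict (cell (w i))) := by
  unfold permMeasure
  refine Finset.sum_congr rfl fun i _ => ?_
  rw [Measure.prod_restrict]
  rfl

theorem permMeasure_fst {n : ℕ} [NeZero n] (w : Equiv.Perm (Fin n)) :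
    (permMeasure w).map Prod.fst = volume := by
  have hn : (n : ℝ≥0∞) ≠ 0 := by exact_mod_cast NeZero.ne n
  rw [permMeasure_eq, Measure.map_finset_sum' (by fun_prop)]
  refine (Finset.sum_congr rfl fun i _ => ?_).trans (sum_restrict_cell n)
  rw [Measure.map_smul, Measure.map_fst_prod, Measure.restrict_apply_univ, volume_cell, smul_smul,
    ENNReal.mul_inv_cancel hn (ENNReal.natCast_ne_top n), one_smul]

theorem permMeasure_snd {n : ℕ} [NeZero n] (w : Equiv.Perm (Fin n)) :
    (permMeasure w).map Prod.snd = volume := by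
  have hn : (n : ℝ≥0∞) ≠ 0 := by exact_mod_cast NeZero.ne n
  rw [permMeasure_eq, Measure.map_finset_sum' (by fun_prop)]
  refine (Finset.sum_congr rfl fun i _ => ?_).trans
    ((Equiv.sum_comp w fun i => (volume : Measure I).restrict (cell i)).trans
      (sum_restrict_cell n))
  rw [Measure.map_smul, Measure.map_snd_prod, Measure.restrict_apply_univ, volume_cell, smul_smul,
    ENNReal.mul_inv_cancel hn (ENNReal.natCast_ne_top n), one_smul]

/-- The permuton associated with a permutation of positive size. -/
noncomputable def permutonOf {n : ℕ} [NeZero n] (w : Equiv.Perm (Fin n)) : Permuton :=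
  ⟨⟨permMeasure w, ⟨by
    have h := congrArg (fun μ : Measure I => μ Set.univ) (permMeasure_fst w)
    simpa [Measure.map_apply measurable_fst MeasurableSet.univ] using h⟩⟩,
    permMeasure_fst w, permMeasure_snd w⟩

end RandomPipeDream

namespace RandomPipeDream

/-! ### Inversions and total displacement -/

/-! The Diaconis–Graham inequalities `inv ≤ displacement ≤ 2 * inv` reduce the bounds to one
asymptotic: the mean displacement is `4 / (3√π) · √(p/(1-p)) · n^(3/2)` to leading order. The factor
2 between the two bounds in the theorem is exactly the loss in these inequalities.

Displacement is a sum over single pipes. Along a pipe, column minus row grows by one at each step,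
so no box is visited twice and each tile met is fresh: the pipe is a Markov chain
(`expectFinal_left`, `expectFinal_bottom`). Away from the diagonal, the sum of column and row
changes from one row to the next by independent centred steps: `-1` with probability `p`, otherwise
a geometric number of crosses. The variance is `2p/(1-p)`, and the central limit theorem with
bounded second moments gives the first absolute moment of this free walk
(`tendsto_walkAbs_div_sqrt`).

The half bumps on the diagonal perturb the recursion. An explicit exponential majorant
(`abs_expectFinal_sub_le`), concentrated within distance about `√n` of the diagonal, bounds the
total error over all pipes by `O(n)` (`abs_integral_displacement_sub_le`), which is negligible
against `n^(3/2)`. Summing `√k` over the pipes yields the factor `2/3`.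

For the permuton limit, the mean distance to the diagonal under the permuton of `w` is at most
`(displacement w + n) / n²`, whose expectation tends to `0`; the uniform marginal then forces
convergence to the identity permuton. -/

/-- The total displacement of a permutation. -/
def displacement {n : ℕ} (w : Equiv.Perm (Fin n)) : ℕ :=
  ∑ i, ((w i : ℤ) - i).natAbs

theorem displacement_inv {n : ℕ} (w : Equiv.Perm (Fin n)) :
    displacement w⁻¹ = displacement w := by
  unfold displacement
  rw [← Equiv.sum_comp w]
  refine Finset.sum_congr rfl fun i _ => ?_
  rw [show w⁻¹ (w i) = i from w.symm_apply_apply i, ← Int.natAbs_neg, neg_sub]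

theorem inv_eq_sum_right {n : ℕ} (w : Equiv.Perm (Fin n)) :
    inv w = ∑ i, (Finset.univ.filter fun j => i < j ∧ w j < w i).card := by
  simp only [inv, Finset.card_filter, ← Finset.univ_product_univ, Finset.sum_product]

theorem inv_eq_sum_left {n : ℕ} (w : Equiv.Perm (Fin n)) :
    inv w = ∑ j, (Finset.univ.filter fun i => i < j ∧ w j < w i).card := by
  simp only [inv, Finset.card_filter, ← Finset.univ_product_univ, Finset.sum_product_right]

/-- One half of the Diaconis–Graham inequality. -/
theorem inv_le_displacement {n : ℕ} (w : Equiv.Perm (Fin n)) : inv w ≤ displacement w := by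
  -- An inversion `i < j` is charged to `i` if `j ≤ w i`, and to `j` if `w i < j`. The truncated
  -- differences below are the positive and negative parts of the displacement.
  have hA (i : Fin n) : (Finset.univ.filter fun j : Fin n => i < j ∧ j ≤ w i).card ≤
      (w i : ℕ) - i := by
    have : (Finset.univ.filter fun j : Fin n => i < j ∧ j ≤ w i) = Finset.Ioc i (w i) := by
      ext j; simp
    rw [this, Fin.card_Ioc]
  have hB (j : Fin n) : (Finset.univ.filter fun i : Fin n => w j < w i ∧ w i < j).card ≤
      (j : ℕ) - w j := by
    have : (Finset.univ.filter fun i : Fin n => w j < w i ∧ w i < j) =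
        (Finset.Ioo (w j) j).map w.symm.toEmbedding := by
      ext i
      simp [Finset.mem_map_equiv]
    rw [this, Finset.card_map, Fin.card_Ioo]
    omega
  calc inv w
    _ ≤ ∑ i, (Finset.univ.filter fun j : Fin n => i < j ∧ j ≤ w i).card +
        ∑ j, (Finset.univ.filter fun i : Fin n => w j < w i ∧ w i < j).card := by
      simp only [inv, Finset.card_filter]
      rw [Finset.sum_comm (f := fun j i : Fin n => if w j < w i ∧ w i < j then 1 else 0),
        ← Finset.sum_add_distrib, ← Finset.univ_product_univ, Finset.sum_product]
      refine Finset.sum_le_sum fun i _ => ?_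
      rw [← Finset.sum_add_distrib]
      refine Finset.sum_le_sum fun j _ => ?_
      rcases le_or_gt j (w i) with h | h <;> by_cases h1 : i < j <;> by_cases h2 : w j < w i <;>
        simp [*]
    _ ≤ ∑ i : Fin n, ((w i : ℕ) - i) + ∑ j : Fin n, ((j : ℕ) - w j) :=
      add_le_add (Finset.sum_le_sum fun i _ => hA i) (Finset.sum_le_sum fun j _ => hB j)
    _ = displacement w := by
      rw [displacement, ← Finset.sum_add_distrib]
      exact Finset.sum_congr rfl fun i _ => by omega

/-- The other half of the Diaconis–Graham inequality. -/
theorem displacement_le_two_mul_inv {n : ℕ} (w : Equiv.Perm (Fin n)) :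
    displacement w ≤ 2 * inv w := by
  -- One copy of `inv` is sorted by left ends and the other by right ends, so the index `i` receives
  -- all inversions that involve it; these number at least `|w i - i|`.
  rw [two_mul]
  nth_rw 1 [inv_eq_sum_right]
  rw [inv_eq_sum_left, displacement, ← Finset.sum_add_distrib]
  refine Finset.sum_le_sum fun i _ => ?_
  have hv : (Finset.univ.filter fun j => w j < w i).card = w i := by
    have : (Finset.univ.filter fun j => w j < w i) = (Finset.Iio (w i)).map w.symm.toEmbedding := by
      ext j
      simp [Finset.mem_map_equiv]
    rw [this, Finset.card_map, Fin.card_Iio]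
  have hi : (Finset.univ.filter fun j => j < i).card = i := by
    have : (Finset.univ.filter fun j => j < i) = Finset.Iio i := by ext j; simp
    rw [this, Fin.card_Iio]
  have h1 : (Finset.univ.filter fun j => w j < w i).card ≤
      (Finset.univ.filter fun j => j < i).card +
        (Finset.univ.filter fun j => i < j ∧ w j < w i).card := by
    refine (Finset.card_le_card fun j hj => ?_).trans (Finset.card_union_le _ _)
    simp only [Finset.mem_filter, Finset.mem_univ, true_and, Finset.mem_union] at hj ⊢
    rcases lt_trichotomy j i with h | h | h
    · exact Or.inl h
    · simp [h] at hj
    · exact Or.inr ⟨h, hj⟩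
  have h2 : (Finset.univ.filter fun j => j < i).card ≤
      (Finset.univ.filter fun j => w j < w i).card +
        (Finset.univ.filter fun j => j < i ∧ w i < w j).card := by
    refine (Finset.card_le_card fun j hj => ?_).trans (Finset.card_union_le _ _)
    simp only [Finset.mem_filter, Finset.mem_univ, true_and, Finset.mem_union] at hj ⊢
    rcases lt_trichotomy (w j) (w i) with h | h | h
    · exact Or.inl h
    · exact absurd (w.injective h) hj.ne
    · exact Or.inr ⟨hj, h⟩
  rw [hv, hi] at h1 h2
  omega

theorem perm_inv_apply {n : ℕ} (D : PipeDream n) (i : Fin n) : (perm D)⁻¹ i = exitMap D i := by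
  simp [perm]

/-- The displacement of the permutation of a pipe dream, pipe by pipe. -/
theorem displacement_perm {n : ℕ} (D : PipeDream n) :
    (displacement (perm D) : ℝ) =
      ∑ i ∈ Finset.range n, |(exitColumn D (i + 1) : ℝ) - ((i : ℝ) + 1)| := by
  rw [← displacement_inv, displacement, Finset.sum_range, Nat.cast_sum]
  refine Finset.sum_congr rfl fun i _ => ?_
  have := exitColumn_mem D (i := i + 1) (by omega) (by omega)
  rw [perm_inv_apply, Nat.cast_natAbs, Int.cast_abs]
  simp only [exitMap]
  push_cast [Nat.cast_sub this.1]
  congr 1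
  ring

/-! ### The evolution of a single pipe -/

/-- The column through which a pipe at position `s` leaves the staircase. -/
def finalColumn {n : ℕ} (D : PipeDream n) (s : Position) : ℕ :=
  ((step D)^[2 * n] s).col

theorem row_iterate_step_of_valid {n : ℕ} (D : PipeDream n) {s : Position} (hs : Valid n s) :
    ((step D)^[2 * n] s).row = 0 := by
  by_contra h
  have hp := iterate_potential D s (2 * n) h
  have hv := hs.iterate D (2 * n)
  unfold Valid at hs hv
  omega

theorem finalColumn_step {n : ℕ} (D : PipeDream n) {s : Position} (hs : Valid n s) :
    finalColumn D (step D s) = finalColumn D s := by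
  unfold finalColumn
  rw [← Function.iterate_succ_apply, Function.iterate_succ_apply',
    step_of_row_eq_zero D (row_iterate_step_of_valid D hs)]

theorem finalColumn_of_row_eq_zero {n : ℕ} (D : PipeDream n) {s : Position} (h : s.row = 0) :
    finalColumn D s = s.col := by
  rw [finalColumn, iterate_of_row_eq_zero D h]

/-- The tile in a box has no influence on the pipes which are beyond this box. -/
theorem finalColumn_update {n : ℕ} (D : PipeDream n) (b : staircase n) (t : Tile) {s : Position}
    (h : b.1.2 + s.row < s.col + b.1.1) :
    finalColumn (Function.update D b t) s = finalColumn D s := by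
  -- Column minus row increases along the path and already exceeds its value at `b`, so the path
  -- never meets `b`.
  have key (k : ℕ) : (step (Function.update D b t))^[k] s = (step D)^[k] s := by
    induction k with
    | zero => rfl
    | succ k ih =>
      rw [Function.iterate_succ_apply', Function.iterate_succ_apply', ih]
      by_cases h0 : ((step D)^[k] s).row = 0
      · rw [step_of_row_eq_zero _ h0, step_of_row_eq_zero _ h0]
      · have hp := iterate_potential D s k h0
        have : tileAt (Function.update D b t) ((step D)^[k] s).row ((step D)^[k] s).col =
            tileAt D ((step D)^[k] s).row ((step D)^[k] s).col := by
          unfold tileAt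
          split_ifs with hb
          · refine Function.update_of_ne (fun he => ?_) _ _
            rw [← he] at h
            simp only at h
            omega
          · rfl
        unfold step at this ⊢
        rw [this]
  rw [finalColumn, finalColumn, key]

theorem integrable_law (p : I) {n : ℕ} (f : PipeDream n → ℝ) : Integrable f (law p n) :=
  .of_finite

/-- Resampling one coordinate of a product measure preserves it: on a product set the fresh tile
supplies the factor at `b`, and the discarded tile contributes `1`. -/
theorem map_update_law (p : I) {n : ℕ} (b : staircase n) :
    ((bernoulliMeasure Tile.cross Tile.bump p).prod (law p n)).map
      (fun x => Function.update x.2 b x.1) = law p n := by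
  symm
  refine Measure.pi_eq fun s hs => ?_
  rw [Measure.map_apply (by fun_prop) (MeasurableSet.univ_pi hs)]
  have : (fun x : Tile × PipeDream n => Function.update x.2 b x.1) ⁻¹' Set.univ.pi s =
      s b ×ˢ Set.univ.pi (Function.update s b Set.univ) := by
    ext ⟨t, D⟩
    simp only [Set.mem_preimage, Set.mem_pi, Set.mem_univ, true_imp_iff, Set.mem_prod]
    constructor
    · refine fun h => ⟨by simpa using h b, fun c => ?_⟩
      by_cases hc : c = b
      · subst hc; simp
      · simpa [hc] using h c
    · rintro ⟨h1, h2⟩ c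
      by_cases hc : c = b
      · subst hc; simpa using h1
      · simpa [hc] using h2 c
  rw [this, Measure.prod_prod, law, Measure.pi_pi, ← Finset.mul_prod_erase _ _ (Finset.mem_univ b),
    ← Finset.mul_prod_erase (a := b) Finset.univ
      (fun i => (bernoulliMeasure Tile.cross Tile.bump p) (s i)) (Finset.mem_univ b)]
  simp only [Function.update_self, measure_univ, one_mul]
  congr 1
  exact Finset.prod_congr rfl fun i hi => by rw [Function.update_of_ne (Finset.ne_of_mem_erase hi)]

/-- Conditioning on the tile in one box. -/
theorem integral_law_update (p : I) {n : ℕ} (b : staircase n) (f : PipeDream n → ℝ) :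
    ∫ D, f D ∂law p n = p * ∫ D, f (Function.update D b Tile.cross) ∂law p n +
      (1 - p) * ∫ D, f (Function.update D b Tile.bump) ∂law p n := by
  nth_rw 1 [← map_update_law p b]
  rw [integral_map (by fun_prop) (by fun_prop), integral_prod _ .of_finite,
    integral_bernoulliMeasure]
  simp

/-- The expectation of a function of the column through which a pipe at position `s` leaves. -/
noncomputable def expectFinal (p : I) (n : ℕ) (φ : ℕ → ℝ) (s : Position) : ℝ :=
  ∫ D, φ (finalColumn D s) ∂law p n

section expectFinal

variable (p : I) (n : ℕ) (φ : ℕ → ℝ)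

theorem expectFinal_row_zero (c : ℕ) (d : Side) : expectFinal p n φ ⟨0, c, d⟩ = φ c := by
  simp [expectFinal, finalColumn_of_row_eq_zero]

variable {n}


/-- The Markov property: condition on the tile in the current box, then use `finalColumn_update` to
forget it, since after one step the pipe is beyond that box. -/
theorem expectFinal_left {r c : ℕ} (hr : 1 ≤ r) (hc : 1 ≤ c) (h : r + c ≤ n) :
    expectFinal p n φ ⟨r, c, Side.left⟩ = p * expectFinal p n φ ⟨r, c + 1, Side.left⟩ +
      (1 - p) * expectFinal p n φ ⟨r - 1, c, Side.bottom⟩ := by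
  have hb : (r, c) ∈ staircase n := mem_staircase.2 ⟨hr, hc, h⟩
  have hv : Valid n ⟨r, c, Side.left⟩ := by simp [Valid]; omega
  unfold expectFinal
  rw [integral_law_update p ⟨(r, c), hb⟩]
  congr 3 <;> ext D <;> rw [← finalColumn_step _ hv] <;>
    simp [step, tileAt, hb, show r ≠ 0 by omega]
  all_goals
    rw [finalColumn_update]
    simp <;> omega

theorem expectFinal_bottom {r c : ℕ} (hr : 1 ≤ r) (hc : 1 ≤ c) (h : r + c ≤ n) :
    expectFinal p n φ ⟨r, c, Side.bottom⟩ = p * expectFinal p n φ ⟨r - 1, c, Side.bottom⟩ +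
      (1 - p) * expectFinal p n φ ⟨r, c + 1, Side.left⟩ := by
  have hb : (r, c) ∈ staircase n := mem_staircase.2 ⟨hr, hc, h⟩
  have hv : Valid n ⟨r, c, Side.bottom⟩ := by simp [Valid]; omega
  unfold expectFinal
  rw [integral_law_update p ⟨(r, c), hb⟩]
  congr 3 <;> ext D <;> rw [← finalColumn_step _ hv] <;>
    simp [step, tileAt, hb, show r ≠ 0 by omega]
  all_goals
    rw [finalColumn_update]
    simp <;> omega

/-- The turn is forced on the diagonal; this is the only place where the recursion departs from that
of the free walk. -/
theorem expectFinal_wall {r c : ℕ} (hr : 1 ≤ r) (hc : 1 ≤ c) (h : r + c = n + 1) :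
    expectFinal p n φ ⟨r, c, Side.left⟩ = expectFinal p n φ ⟨r - 1, c, Side.bottom⟩ := by
  have hb : (r, c) ∉ staircase n := fun hb => by have := mem_staircase.1 hb; omega
  have hv : Valid n ⟨r, c, Side.left⟩ := by simp [Valid]; omega
  unfold expectFinal
  congr 1
  ext D
  rw [← finalColumn_step _ hv]
  simp [step, tileAt, hb, show r ≠ 0 by omega]

end expectFinal

/-! ### Geometric random variables -/

section Geometric

variable {p : I}

theorem one_sub_pos (hp : (p : ℝ) < 1) : 0 < 1 - (p : ℝ) := sub_pos.2 hp

theorem symm_ne_zero (hp : (p : ℝ) < 1) : σ p ≠ 0 := by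
  intro h
  have := congrArg Subtype.val h
  simp at this
  linarith

/-- The law of the number of crosses before the first bump. -/
noncomputable def crossLaw (p : I) : Measure ℕ := geometricMeasure (σ p)

instance : IsProbabilityMeasure (crossLaw p) := by
  unfold crossLaw
  infer_instance

theorem integrable_crossLaw_iff (hp : (p : ℝ) < 1) {f : ℕ → ℝ} :
    Integrable f (crossLaw p) ↔ Summable fun n => (p : ℝ) ^ n * |f n| := by
  rw [crossLaw, integrable_geometricMeasure_iff (symm_ne_zero hp)]
  have (n : ℕ) : (1 - (σ p : ℝ)) ^ n * (σ p : ℝ) * ‖f n‖ =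
      (1 - p : ℝ) * ((p : ℝ) ^ n * |f n|) := by
    simp
    ring
  simp_rw [this]
  exact summable_mul_left_iff (one_sub_pos hp).ne'

theorem integrable_crossLaw_pow (hp : (p : ℝ) < 1) (m : ℕ) :
    Integrable (fun k : ℕ => (k : ℝ) ^ m) (crossLaw p) := by
  rw [integrable_crossLaw_iff hp]
  have := summable_pow_mul_geometric_of_norm_lt_one (R := ℝ) m (r := p)
    (by rw [Real.norm_of_nonneg p.2.1]; exact hp)
  refine this.congr fun n => ?_
  rw [abs_of_nonneg (by positivity), mul_comm]

theorem integrable_crossLaw_cast (hp : (p : ℝ) < 1) :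
    Integrable (fun k : ℕ => (k : ℝ)) (crossLaw p) := by
  simpa using integrable_crossLaw_pow hp 1

theorem integrable_crossLaw_comp_succ (hp : (p : ℝ) < 1) {f : ℕ → ℝ}
    (hf : Integrable f (crossLaw p)) : Integrable (fun k => f (k + 1)) (crossLaw p) := by
  -- For `p = 0` the shifted series cannot be rescaled by `p⁻¹`, but it has a single nonzero term at
  -- most.
  rcases eq_or_ne (p : ℝ) 0 with h0 | h0
  · rw [integrable_crossLaw_iff hp]
    refine summable_of_ne_finset_zero (s := {0}) fun k hk => ?_
    have : k ≠ 0 := by simpa using hk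
    simp [h0, this]
  · rw [integrable_crossLaw_iff hp] at hf ⊢
    rw [← summable_nat_add_iff 1] at hf
    refine (hf.mul_left (p : ℝ)⁻¹).congr fun k => ?_
    rw [pow_succ]
    field_simp

/-- Memorylessness of the geometric law. It yields both moments as well as the recursion
`walkAbsLeft_eq`. -/
theorem integral_crossLaw_succ (hp : (p : ℝ) < 1) {f : ℕ → ℝ} (hf : Integrable f (crossLaw p)) :
    ∫ k, f k ∂crossLaw p = p * ∫ k, f (k + 1) ∂crossLaw p + (1 - p) * f 0 := by
  have h1 := hasSum_integral_geometricMeasure (symm_ne_zero hp) hf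
  have h2 := hasSum_integral_geometricMeasure (symm_ne_zero hp) (integrable_crossLaw_comp_succ hp hf)
  simp only [unitInterval.coe_symm_eq, sub_sub_cancel, smul_eq_mul] at h1 h2
  have h3 := (hasSum_nat_add_iff' 1).2 h1
  have h4 := h3.unique ((h2.mul_left (p : ℝ)).congr_fun fun k => by ring)
  simp only [Finset.sum_range_one, pow_zero, one_mul] at h4
  unfold crossLaw
  linarith

theorem integral_crossLaw_cast (hp : (p : ℝ) < 1) :
    ∫ k, (k : ℝ) ∂crossLaw p = p / (1 - p) := by
  have hi := integrable_crossLaw_cast hp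
  have h := integral_crossLaw_succ hp hi
  simp only [Nat.cast_add, Nat.cast_one, Nat.cast_zero] at h
  rw [integral_add hi (integrable_const _)] at h
  simp only [integral_const, probReal_univ, one_smul] at h
  rw [eq_div_iff (one_sub_pos hp).ne']
  linarith

theorem integral_crossLaw_sq (hp : (p : ℝ) < 1) :
    ∫ k, (k : ℝ) ^ 2 ∂crossLaw p = p * (1 + p) / (1 - p) ^ 2 := by
  have hi := integrable_crossLaw_cast hp
  have hi2 := integrable_crossLaw_pow hp 2
  have h := integral_crossLaw_succ hp hi2
  simp only [Nat.cast_add, Nat.cast_one, Nat.cast_zero] at h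
  have he : ∀ k : ℕ, ((k : ℝ) + 1) ^ 2 = (k : ℝ) ^ 2 + (2 * k + 1) := fun k => by ring
  simp_rw [he] at h
  rw [integral_add (g := fun k : ℕ => 2 * (k : ℝ) + 1) hi2
      ((hi.const_mul 2).add (integrable_const _)),
    integral_add (hi.const_mul 2) (integrable_const _), integral_const_mul,
    integral_crossLaw_cast hp] at h
  simp only [integral_const, probReal_univ, one_smul] at h
  have hq := (one_sub_pos hp).ne'
  rw [eq_div_iff (pow_ne_zero 2 hq)]
  have h5 : (1 - (p : ℝ)) * ∫ k, (k : ℝ) ^ 2 ∂crossLaw p = p * (2 * (p / (1 - p)) + 1) := by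
    linarith
  calc (∫ k, (k : ℝ) ^ 2 ∂crossLaw p) * (1 - (p : ℝ)) ^ 2
      = (1 - (p : ℝ)) * ((1 - (p : ℝ)) * ∫ k, (k : ℝ) ^ 2 ∂crossLaw p) := by ring
    _ = _ := by rw [h5]; field_simp; ring

/-! ### The free walk -/

theorem integrable_crossLaw_shift (hp : (p : ℝ) < 1) {f : ℝ → ℝ}
    (hf : ∀ y z, |f y - f z| ≤ |y - z|) (z : ℝ) :
    Integrable (fun k : ℕ => f (z + k)) (crossLaw p) := by
  refine ((integrable_const |f z|).add (integrable_crossLaw_cast hp)).mono'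
    (measurable_of_countable _).aestronglyMeasurable (ae_of_all _ fun k => ?_)
  have h1 := hf (z + k) z
  rw [add_sub_cancel_left, Nat.abs_cast] at h1
  have h2 := abs_sub_abs_le_abs_sub (f (z + k)) (f z)
  simp only [Pi.add_apply, Real.norm_eq_abs]
  linarith

theorem abs_integral_crossLaw_shift_sub_le (hp : (p : ℝ) < 1) {f : ℝ → ℝ}
    (hf : ∀ y z, |f y - f z| ≤ |y - z|) (z : ℝ) :
    |∫ k : ℕ, f (z + k) ∂crossLaw p - f z| ≤ p / (1 - p) := by
  have h : ∫ k : ℕ, f (z + k) ∂crossLaw p - f z = ∫ k : ℕ, (f (z + k) - f z) ∂crossLaw p := by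
    rw [integral_sub (integrable_crossLaw_shift hp hf z) (integrable_const _)]
    simp
  rw [h, ← integral_crossLaw_cast hp]
  refine abs_integral_le_integral_abs.trans (integral_mono
    ((integrable_crossLaw_shift hp hf z).sub (integrable_const _)).abs
    (integrable_crossLaw_cast hp) fun k => ?_)
  simpa using hf (z + k) z

/-- The expectation of `|z + S|`, where `S` is the sum of `k` independent steps. A step is the
number of columns by which a pipe that enters a row from the bottom advances in this row of a
quadrant without walls, minus `1`. -/
noncomputable def walkAbs (p : I) : ℕ → ℝ → ℝ
  | 0, z => |z|
  | k + 1, z => p * walkAbs p k (z - 1) + (1 - p) * ∫ j : ℕ, walkAbs p k (z + j) ∂crossLaw p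

theorem abs_walkAbs_sub_le (hp : (p : ℝ) < 1) (k : ℕ) (y z : ℝ) :
    |walkAbs p k y - walkAbs p k z| ≤ |y - z| := by
  induction k generalizing y z with
  | zero => exact abs_abs_sub_abs_le_abs_sub y z
  | succ k ih =>
    have hq := one_sub_pos hp
    have h1 := ih (y - 1) (z - 1)
    rw [sub_sub_sub_cancel_right] at h1
    have h2 : |∫ j : ℕ, walkAbs p k (y + j) ∂crossLaw p -
        ∫ j : ℕ, walkAbs p k (z + j) ∂crossLaw p| ≤ |y - z| := by
      rw [← integral_sub (integrable_crossLaw_shift hp ih y) (integrable_crossLaw_shift hp ih z)]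
      refine abs_integral_le_integral_abs.trans ((integral_mono
        ((integrable_crossLaw_shift hp ih y).sub (integrable_crossLaw_shift hp ih z)).abs
        (integrable_const |y - z|) fun j => ?_).trans_eq (by simp))
      simpa using ih (y + j) (z + j)
    simp only [walkAbs]
    rw [abs_le] at h1 h2 ⊢
    constructor <;> nlinarith [p.2.1]

/-- The analogue of `walkAbs` for a pipe which enters a row from the left. -/
noncomputable def walkAbsLeft (p : I) (k : ℕ) (z : ℝ) : ℝ :=
  ∫ j : ℕ, walkAbs p k (z + j) ∂crossLaw p

theorem walkAbs_succ (k : ℕ) (z : ℝ) :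
    walkAbs p (k + 1) z = p * walkAbs p k (z - 1) + (1 - p) * walkAbsLeft p k z := rfl

/-- The counterpart of `expectFinal_left`, so that differences between pipe and free walk obey a
linear recursion. -/
theorem walkAbsLeft_eq (hp : (p : ℝ) < 1) (k : ℕ) (z : ℝ) :
    walkAbsLeft p k z = p * walkAbsLeft p k (z + 1) + (1 - p) * walkAbs p k z := by
  unfold walkAbsLeft
  rw [integral_crossLaw_succ hp (integrable_crossLaw_shift hp (abs_walkAbs_sub_le hp k) z)]
  simp [add_assoc, add_comm (1 : ℝ)]

/-- By the Lipschitz property, suppressing a run of crosses costs at most its mean length. This is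
the price of the forced turn at the wall, and of the horizontal start of a pipe. -/
theorem abs_walkAbsLeft_sub_walkAbs_le (hp : (p : ℝ) < 1) (k : ℕ) (z : ℝ) :
    |walkAbsLeft p k z - walkAbs p k z| ≤ p / (1 - p) :=
  abs_integral_crossLaw_shift_sub_le hp (abs_walkAbs_sub_le hp k) z

end Geometric

/-! ### Comparison of a pipe with the free walk -/

section Comparison

variable {p : I}

/-- The expected displacement of a pipe differs from that of the free walk by at most a solution
of the same recursion that gains enough at the wall. -/
theorem abs_expectFinal_sub_le (hp : (p : ℝ) < 1) {n : ℕ} (i : ℝ) {C y M κ : ℝ} (hC : 0 ≤ C)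
    (hy : 1 ≤ y) (hM : M = p * y * M + (1 - p)) (hM1 : 1 ≤ M) (hκ : 1 ≤ κ)
    (hκM : κ * y = p + (1 - p) * M * y) (hwall : p / (1 - p) ≤ C * y ^ n * (M - 1)) (m : ℕ) :
    (∀ r c : ℕ, 1 ≤ c → r + c ≤ n → n + (r + 1) ≤ c + m →
      |expectFinal p n (fun c => |(c : ℝ) - i|) ⟨r + 1, c, Side.left⟩ -
        walkAbsLeft p r (c + r - i)| ≤ C * κ ^ r * M * y ^ (c + r)) ∧
    (∀ r c : ℕ, 1 ≤ c → r + c ≤ n → n + r ≤ c + m →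
      |expectFinal p n (fun c => |(c : ℝ) - i|) ⟨r, c, Side.bottom⟩ -
        walkAbs p r (c + r - i)| ≤ C * κ ^ r * y ^ (c + r)) := by
  have hq := one_sub_pos hp
  have hp0 : (0 : ℝ) ≤ p := p.2.1
  have hzero (c : ℕ) : |expectFinal p n (fun c => |(c : ℝ) - i|) ⟨0, c, Side.bottom⟩ -
        walkAbs p 0 (c + (0 : ℕ) - i)| ≤ C * κ ^ 0 * y ^ (c + 0) := by
    rw [expectFinal_row_zero]
    simp only [walkAbs, Nat.cast_zero, add_zero, sub_self, abs_zero]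
    positivity
  -- `m` bounds `n + row - col`, which drops by one at each step. Entering row `r + 1` from the left
  -- leaves `r` free steps to make, hence the shift between the two statements.
  induction m with
  | zero =>
    refine ⟨fun r c _ _ _ => by omega, fun r c h1 h2 h3 => ?_⟩
    obtain rfl : r = 0 := by omega
    exact hzero c
  | succ m ih =>
    refine ⟨fun r c h1 h2 h3 => ?_, fun r c h1 h2 h3 => ?_⟩
    · have ihb := ih.2 r c h1 h2 (by omega)
      rcases Nat.lt_or_ge n (r + 1 + c) with hw | hw
      · rw [expectFinal_wall p _ (by omega) h1 (by omega), Nat.add_sub_cancel]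
        have hd := abs_walkAbsLeft_sub_walkAbs_le hp r (c + r - i)
        have hn : c + r = n := by omega
        have hCy : 0 ≤ C * y ^ n * (M - 1) := by
          have := sub_nonneg.2 hM1
          positivity
        -- At the wall the gap between the left and bottom majorants absorbs the cost `p / (1 - p)`
        -- of the forced turn.
        have hstep : C * y ^ n * (M - 1) ≤ C * κ ^ r * M * y ^ (c + r) -
            C * κ ^ r * y ^ (c + r) := by
          rw [hn]
          calc C * y ^ n * (M - 1) ≤ C * y ^ n * (M - 1) * κ ^ r :=
                le_mul_of_one_le_right hCy (one_le_pow₀ hκ)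
            _ = _ := by ring
        rw [abs_le] at ihb hd ⊢
        constructor <;> linarith [ihb.1, ihb.2, hd.1, hd.2]
      · have ihl := ih.1 r (c + 1) (by omega) (by omega) (by omega)
        rw [expectFinal_left p _ (by omega) h1 hw, Nat.add_sub_cancel, walkAbsLeft_eq hp]
        have he : ((c + 1 : ℕ) : ℝ) + r - i = c + r - i + 1 := by push_cast; ring
        rw [he] at ihl
        -- `hM` says precisely that the majorant solves the recursion for entry from the left; `hκM`
        -- does the same for entry from the bottom.
        have hb : C * κ ^ r * M * y ^ (c + r) = p * (C * κ ^ r * M * y ^ (c + 1 + r)) +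
            (1 - p) * (C * κ ^ r * y ^ (c + r)) := by
          calc C * κ ^ r * M * y ^ (c + r) =
                C * κ ^ r * (p * y * M + (1 - p)) * y ^ (c + r) := by rw [← hM]
            _ = _ := by ring
        rw [hb]
        rw [abs_le] at ihb ihl ⊢
        constructor <;> nlinarith [ihb.1, ihb.2, ihl.1, ihl.2]
    · cases r with
      | zero => exact hzero c
      | succ r =>
        have ihb := ih.2 r c h1 (by omega) (by omega)
        have ihl := ih.1 r (c + 1) (by omega) (by omega) (by omega)
        rw [expectFinal_bottom p _ (by omega) h1 h2, Nat.add_sub_cancel, walkAbs_succ]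
        have he : ((c + 1 : ℕ) : ℝ) + r - i = c + (r + 1 : ℕ) - i := by push_cast; ring
        have he' : (c : ℝ) + r - i = c + (r + 1 : ℕ) - i - 1 := by push_cast; ring
        rw [he] at ihl
        rw [he'] at ihb
        have hb : C * κ ^ (r + 1) * y ^ (c + (r + 1)) = p * (C * κ ^ r * y ^ (c + r)) +
            (1 - p) * (C * κ ^ r * M * y ^ (c + 1 + r)) := by
          calc C * κ ^ (r + 1) * y ^ (c + (r + 1)) = C * κ ^ r * y ^ (c + r) * (κ * y) := by ring
            _ = _ := by rw [hκM]; ring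
        rw [hb]
        rw [abs_le] at ihb ihl ⊢
        constructor <;> nlinarith [ihb.1, ihb.2, ihl.1, ihl.2]

theorem integral_displacement_eq (p : I) (n : ℕ) :
    ∫ D, (displacement (perm D) : ℝ) ∂law p n =
      ∑ i ∈ Finset.range n,
        expectFinal p n (fun c => |(c : ℝ) - ((i : ℝ) + 1)|) ⟨i + 1, 1, Side.left⟩ := by
  simp_rw [displacement_perm]
  rw [integral_finsetSum _ fun i _ => integrable_law p _]
  rfl

/-- Each pipe starts at `z = 0`. The first error term replaces `walkAbsLeft` by `walkAbs`; the
second sums the majorant over the starting positions. -/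
theorem abs_integral_displacement_sub_le_of_majorant (hp : (p : ℝ) < 1) {n : ℕ} {C y M κ : ℝ}
    (hC : 0 ≤ C) (hy : 1 ≤ y) (hM : M = p * y * M + (1 - p)) (hM1 : 1 ≤ M) (hκ : 1 ≤ κ)
    (hκM : κ * y = p + (1 - p) * M * y) (hwall : p / (1 - p) ≤ C * y ^ n * (M - 1)) :
    |∫ D, (displacement (perm D) : ℝ) ∂law p n - ∑ k ∈ Finset.range n, walkAbs p k 0| ≤
      n * (p / (1 - p)) + C * M * κ ^ n * ∑ k ∈ Finset.range n, y ^ (k + 1) := by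
  rw [integral_displacement_eq, ← Finset.sum_sub_distrib, Finset.mul_sum]
  have hn : (n : ℝ) * (p / (1 - p)) = ∑ k ∈ Finset.range n, (p / (1 - p) : ℝ) := by simp
  rw [hn, ← Finset.sum_add_distrib]
  refine (Finset.abs_sum_le_sum_abs _ _).trans (Finset.sum_le_sum fun i hi => ?_)
  have hi := Finset.mem_range.1 hi
  have h1 := (abs_expectFinal_sub_le hp ((i : ℝ) + 1) hC hy hM hM1 hκ hκM hwall (n + n)).1 i 1
    le_rfl (by omega) (by omega)
  have hz : ((1 : ℕ) : ℝ) + i - (i + 1) = 0 := by push_cast; ring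
  rw [hz] at h1
  have h2 := abs_walkAbsLeft_sub_walkAbs_le hp i 0
  have h3 : C * κ ^ i * M * y ^ (1 + i) ≤ C * M * κ ^ n * y ^ (i + 1) := by
    rw [add_comm 1 i, mul_right_comm C]
    gcongr
  rw [abs_le] at h1 h2 ⊢
  constructor <;> linarith [h1.1, h1.2, h2.1, h2.2]

theorem abs_integral_displacement_sub_le (hp : (p : ℝ) < 1) {n : ℕ} (hn : 1 ≤ n)
    (hpn : 2 * (p / (1 - p) : ℝ) ≤ √n) :
    |∫ D, (displacement (perm D) : ℝ) ∂law p n - ∑ k ∈ Finset.range n, walkAbs p k 0| ≤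
      (p / (1 - p) + 4 * Real.exp (2 * (p / (1 - p)))) * n := by
  have hq := one_sub_pos hp
  have hp0 : (0 : ℝ) ≤ p := p.2.1
  obtain ⟨θ, hθ⟩ : ∃ θ : ℝ, θ = p / (1 - p) := ⟨_, rfl⟩
  have hpθ : (p : ℝ) = θ * (1 - p) := by rw [hθ]; field_simp
  rw [← hθ] at hpn ⊢
  have hθ0 : 0 ≤ θ := by rw [hθ]; positivity
  have hn1 : (1 : ℝ) ≤ n := by exact_mod_cast hn
  have hs1 : 1 ≤ √(n : ℝ) := Real.one_le_sqrt.2 hn1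
  have hs0 : 0 < √(n : ℝ) := by linarith
  -- The scale `x = 1/√n` in `y = 1 + x` balances two effects: `κ - 1` is of order `x²`, so `κ ^ n`
  -- stays bounded, while the sum of `y ^ (k + 1)` costs only `1/x` times `y ^ n`.
  obtain ⟨x, hx⟩ : ∃ x : ℝ, x = (√(n : ℝ))⁻¹ := ⟨_, rfl⟩
  have hx0 : 0 < x := by rw [hx]; positivity
  have hx1 : x ≤ 1 := by rw [hx]; exact inv_le_one_of_one_le₀ hs1
  have hxn : x ^ 2 * n = 1 := by
    rw [hx, inv_pow, Real.sq_sqrt (by positivity)]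
    field_simp
  have hxi : x⁻¹ * x⁻¹ = n := by
    field_simp
    linarith
  have hθx : θ * x ≤ 1 / 2 := by
    rw [hx, ← div_eq_mul_inv, div_le_iff₀ hs0]
    linarith
  obtain ⟨u, hu⟩ : ∃ u : ℝ, u = 1 - θ * x := ⟨_, rfl⟩
  have hu2 : 1 / 2 ≤ u := by linarith
  have hu1 : u ≤ 1 := by rw [hu]; linarith [mul_nonneg hθ0 hx0.le]
  have hu0 : 0 < u := by linarith
  have hM2 : u⁻¹ ≤ 2 := by
    rw [inv_le_comm₀ hu0 two_pos]
    linarith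
  have hκ' : θ * x ^ 2 / ((1 + x) * u) ≤ 2 * θ / n := by
    rw [div_le_div_iff₀ (by positivity) (by positivity), mul_assoc, hxn]
    nlinarith
  have hκ0 : 0 ≤ θ * x ^ 2 / ((1 + x) * u) := by positivity
  have hpow : 0 < (1 + x) ^ n := by positivity
  -- `M` and `κ` are forced by `y` through the two recursions. `M - 1` is `θ * x / u`, so the factor
  -- `x⁻¹` in `C` meets the wall condition; with the `1/x` from the geometric sum, the error is of
  -- order `x⁻² = n`.
  have key := abs_integral_displacement_sub_le_of_majorant hp (n := n)
    (C := x⁻¹ / (1 + x) ^ n) (y := 1 + x) (M := u⁻¹) (κ := 1 + θ * x ^ 2 / ((1 + x) * u))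
    (by positivity) (by linarith) (by
      field_simp
      rw [hu]
      linear_combination (-x) * hpθ) (one_le_inv_iff₀.2 ⟨hu0, hu1⟩) (by linarith) (by
      field_simp
      rw [hu]
      linear_combination x * hpθ) (by
      rw [← hθ, div_mul_cancel₀ _ hpow.ne']
      have : x⁻¹ * (u⁻¹ - 1) = θ / u := by
        field_simp
        rw [hu]
        ring
      rw [this, le_div_iff₀ hu0]
      nlinarith)
  rw [← hθ] at key
  refine key.trans ?_
  have hgeom : ∑ k ∈ Finset.range n, (1 + x) ^ (k + 1) ≤ 2 * (1 + x) ^ n / x := by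
    have hg := geom_sum_mul (1 + x) n
    rw [add_sub_cancel_left] at hg
    rw [le_div_iff₀ hx0]
    simp_rw [pow_succ]
    rw [← Finset.sum_mul, mul_right_comm, hg]
    nlinarith
  have hexp : (1 + θ * x ^ 2 / ((1 + x) * u)) ^ n ≤ Real.exp (2 * θ) := by
    calc (1 + θ * x ^ 2 / ((1 + x) * u)) ^ n ≤ (Real.exp (2 * θ / n)) ^ n := by
          gcongr
          linarith [Real.add_one_le_exp (2 * θ / n)]
      _ = Real.exp (2 * θ) := by
          rw [← Real.exp_nat_mul, mul_div_left_comm, div_self (by positivity), mul_one]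
  have hc : 0 ≤ x⁻¹ / (1 + x) ^ n := div_nonneg (inv_nonneg.2 hx0.le) hpow.le
  have he : 0 ≤ (1 + θ * x ^ 2 / ((1 + x) * u)) ^ n := pow_nonneg (by linarith) n
  have hg : 0 ≤ ∑ k ∈ Finset.range n, (1 + x) ^ (k + 1) :=
    Finset.sum_nonneg fun k _ => pow_nonneg (by linarith) _
  calc n * θ + x⁻¹ / (1 + x) ^ n * u⁻¹ * (1 + θ * x ^ 2 / ((1 + x) * u)) ^ n *
        ∑ k ∈ Finset.range n, (1 + x) ^ (k + 1)
      ≤ n * θ + x⁻¹ / (1 + x) ^ n * 2 * Real.exp (2 * θ) * (2 * (1 + x) ^ n / x) :=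
        add_le_add_right (mul_le_mul (mul_le_mul (mul_le_mul_of_nonneg_left hM2 hc)
          hexp he (mul_nonneg hc two_pos.le)) hgeom hg
          (mul_nonneg (mul_nonneg hc two_pos.le) (Real.exp_pos _).le)) _
    _ = n * θ + 4 * Real.exp (2 * θ) * (x⁻¹ * x⁻¹) * ((1 + x) ^ n / (1 + x) ^ n) := by ring
    _ = _ := by
        rw [div_self hpow.ne', hxi]
        ring

/-- Without crosses the wall costs nothing, so the zero majorant `C = 0` is admissible, and the free
walk does not move. -/
theorem integral_displacement_of_eq_zero (h0 : (p : ℝ) = 0) (n : ℕ) :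
    ∫ D, (displacement (perm D) : ℝ) ∂law p n = 0 := by
  have hp : (p : ℝ) < 1 := by rw [h0]; exact one_pos
  have key := abs_integral_displacement_sub_le_of_majorant hp (n := n) (C := 0) (y := 1) (M := 1)
    (κ := 1) le_rfl le_rfl (by simp [h0]) le_rfl le_rfl (by simp [h0]) (by simp [h0])
  have hw (k : ℕ) (z : ℝ) : walkAbs p k z = |z| := by
    induction k generalizing z with
    | zero => rfl
    | succ k ih =>
      have := walkAbsLeft_eq hp k z
      simp [walkAbs_succ, this, h0, ih]
  simpa [hw, h0] using key

end Comparison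

/-! ### Convergence of first absolute moments -/

theorem abs_sub_min_le {M : ℝ} (hM : 0 < M) (x : ℝ) : |(|x| - min |x| M)| ≤ x ^ 2 / M := by
  rw [le_div_iff₀ hM, ← sq_abs]
  rcases le_total |x| M with h | h
  · simp [min_eq_left h, sq_nonneg]
  · rw [min_eq_right h, abs_of_nonneg (sub_nonneg.2 h)]
    nlinarith [abs_nonneg x]

theorem abs_integral_abs_sub_le {μ : Measure ℝ} [IsProbabilityMeasure μ] {B M : ℝ} (hM : 0 < M)
    (hi : Integrable (fun x : ℝ => x ^ 2) μ) (hB : ∫ x, x ^ 2 ∂μ ≤ B) :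
    |∫ x, |x| ∂μ - ∫ x, min |x| M ∂μ| ≤ B / M := by
  have h2 : MemLp id 2 μ := (memLp_two_iff_integrable_sq measurable_id.aestronglyMeasurable).2 hi
  have h1 : Integrable (fun x : ℝ => |x|) μ := (h2.integrable one_le_two).abs
  have h3 : Integrable (fun x : ℝ => min |x| M) μ := h1.inf (integrable_const M)
  rw [← integral_sub h1 h3]
  calc |∫ x, (|x| - min |x| M) ∂μ| ≤ ∫ x, |(|x| - min |x| M)| ∂μ := abs_integral_le_integral_abs
    _ ≤ ∫ x, x ^ 2 / M ∂μ := integral_mono (h1.sub h3).abs (hi.div_const M) (abs_sub_min_le hM)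
    _ = (∫ x, x ^ 2 ∂μ) / M := integral_div M _
    _ ≤ B / M := by gcongr

/-- Weak convergence with bounded second moments implies convergence of first absolute moments. -/
theorem tendsto_integral_abs_of_tendsto {μs : ℕ → ProbabilityMeasure ℝ} {μ : ProbabilityMeasure ℝ}
    (h : Tendsto μs atTop (𝓝 μ)) {B : ℝ}
    (hi : ∀ n, Integrable (fun x : ℝ => x ^ 2) (μs n : Measure ℝ))
    (hB : ∀ n, ∫ x, x ^ 2 ∂(μs n : Measure ℝ) ≤ B)
    (hi' : Integrable (fun x : ℝ => x ^ 2) (μ : Measure ℝ))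
    (hB' : ∫ x, x ^ 2 ∂(μ : Measure ℝ) ≤ B) :
    Tendsto (fun n => ∫ x, |x| ∂(μs n : Measure ℝ)) atTop (𝓝 (∫ x, |x| ∂(μ : Measure ℝ))) := by
  rw [Metric.tendsto_atTop]
  intro ε hε
  have hB0 : 0 ≤ B := (integral_nonneg fun x => sq_nonneg x).trans hB'
  -- Truncation at level `M` costs at most `B / M` on either side; `B + 1` keeps `M` positive when
  -- `B = 0`.
  obtain ⟨M, hM⟩ : ∃ M, M = 4 * (B + 1) / ε := ⟨_, rfl⟩
  have hM0 : 0 < M := by rw [hM]; positivity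
  have hBM : B / M < ε / 3 := by
    rw [div_lt_iff₀ hM0, hM]
    field_simp
    linarith
  let f : BoundedContinuousFunction ℝ ℝ := BoundedContinuousFunction.ofNormedAddCommGroup
    (fun x => min |x| M) (by fun_prop) M fun x => by
      rw [Real.norm_of_nonneg (le_min (abs_nonneg x) hM0.le)]
      exact min_le_right _ _
  have hf := ProbabilityMeasure.tendsto_iff_forall_integral_tendsto.1 h f
  obtain ⟨N, hN⟩ := Metric.tendsto_atTop.1 hf (ε / 3) (by positivity)
  refine ⟨N, fun n hn => ?_⟩
  have h1 := hN n hn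
  have h2 := abs_integral_abs_sub_le hM0 (hi n) (hB n)
  have h3 := abs_integral_abs_sub_le hM0 hi' hB'
  change |∫ x, min |x| M ∂(μs n : Measure ℝ) - ∫ x, min |x| M ∂(μ : Measure ℝ)| < ε / 3 at h1
  rw [Real.dist_eq]
  rw [abs_lt] at h1 ⊢
  rw [abs_le] at h2 h3
  constructor <;> linarith [h1.1, h1.2, h2.1, h2.2, h3.1, h3.2]

/-- The density is even, so the integral is twice a Gamma-type integral over the half-line. -/
theorem integral_abs_gaussianReal {v : NNReal} (hv : v ≠ 0) :
    ∫ x, |x| ∂gaussianReal 0 v = √(2 * v / Real.pi) := by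
  have hv0 : (0 : ℝ) < v := by exact_mod_cast pos_iff_ne_zero.2 hv
  rw [integral_gaussianReal_eq_integral_smul hv]
  have h1 (x : ℝ) : gaussianPDFReal 0 v x • |x| = (fun y => (√(2 * Real.pi * v))⁻¹ *
      (y ^ (1 : ℝ) * Real.exp (-(1 / (2 * v)) * y ^ (2 : ℝ)))) |x| := by
    simp only [gaussianPDFReal, smul_eq_mul, Real.rpow_one, Real.rpow_ofNat, sq_abs, sub_zero]
    rw [show -x ^ 2 / (2 * (v : ℝ)) = -(1 / (2 * v)) * x ^ 2 by ring]
    ring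
  simp_rw [h1]
  rw [integral_comp_abs (f := fun y : ℝ => (√(2 * Real.pi * v))⁻¹ *
      (y ^ (1 : ℝ) * Real.exp (-(1 / (2 * v)) * y ^ (2 : ℝ)))), integral_const_mul,
    integral_rpow_mul_exp_neg_mul_rpow two_pos (by norm_num) (by positivity)]
  norm_num [Real.rpow_neg_one]
  field_simp
  rw [Real.sq_sqrt two_pos.le, Real.sq_sqrt hv0.le, mul_comm]

/-! ### The free walk as a sum of independent variables -/

section StepLaw

variable {p : I}

/-- The law of one step of the free walk. -/
noncomputable def stepLaw (p : I) : Measure ℝ :=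
  unitInterval.toNNReal p • Measure.dirac (-1) +
    unitInterval.toNNReal (σ p) • (crossLaw p).map (fun k : ℕ => (k : ℝ))

instance : IsProbabilityMeasure (stepLaw p) where
  measure_univ := by
    have : IsProbabilityMeasure ((crossLaw p).map (fun k : ℕ => (k : ℝ))) :=
      Measure.isProbabilityMeasure_map (by fun_prop)
    simp [stepLaw]

theorem integrable_stepLaw {f : ℝ → ℝ} (hf : StronglyMeasurable f)
    (hi : Integrable (fun k : ℕ => f k) (crossLaw p)) : Integrable f (stepLaw p) := by
  refine Integrable.add_measure ?_ ?_
  · exact (integrable_dirac (by simp)).smul_measure_nnreal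
  · refine Integrable.smul_measure_nnreal ?_
    rwa [integrable_map_measure hf.aestronglyMeasurable (by fun_prop)]

theorem integral_stepLaw {f : ℝ → ℝ} (hf : StronglyMeasurable f)
    (hi : Integrable (fun k : ℕ => f k) (crossLaw p)) :
    ∫ x, f x ∂stepLaw p = p * f (-1) + (1 - p) * ∫ k : ℕ, f k ∂crossLaw p := by
  have hi' : Integrable f ((crossLaw p).map (fun k : ℕ => (k : ℝ))) := by
    rwa [integrable_map_measure hf.aestronglyMeasurable (by fun_prop)]
  rw [stepLaw, integral_add_measure ((integrable_dirac (by simp)).smul_measure_nnreal)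
    hi'.smul_measure_nnreal, integral_smul_nnreal_measure, integral_smul_nnreal_measure,
    integral_dirac, integral_map (by fun_prop) hf.aestronglyMeasurable]
  simp [NNReal.smul_def]

theorem memLp_two_stepLaw (hp : (p : ℝ) < 1) : MemLp id 2 (stepLaw p) :=
  (memLp_two_iff_integrable_sq measurable_id.aestronglyMeasurable).2
    (integrable_stepLaw (by fun_prop) (integrable_crossLaw_pow hp 2))

theorem integral_id_stepLaw (hp : (p : ℝ) < 1) : ∫ x, x ∂stepLaw p = 0 := by
  rw [integral_stepLaw (by fun_prop) (integrable_crossLaw_cast hp), integral_crossLaw_cast hp]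
  have := (one_sub_pos hp).ne'
  field_simp
  ring

theorem integral_sq_stepLaw (hp : (p : ℝ) < 1) :
    ∫ x, x ^ 2 ∂stepLaw p = 2 * (p / (1 - p)) := by
  rw [integral_stepLaw (by fun_prop) (integrable_crossLaw_pow hp 2), integral_crossLaw_sq hp]
  have := (one_sub_pos hp).ne'
  field_simp
  ring

variable {Ω : Type*} [MeasurableSpace Ω] {P : Measure Ω} {X : ℕ → Ω → ℝ}

theorem memLp_two_of_hasLaw (hp : (p : ℝ) < 1) (hlaw : ∀ i, HasLaw (X i) (stepLaw p) P) (i : ℕ) :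
    MemLp (X i) 2 P := by
  have := memLp_two_stepLaw hp
  rw [← (hlaw i).map_eq, memLp_map_measure_iff (by fun_prop) (hlaw i).aemeasurable] at this
  exact this

theorem integral_of_hasLaw (hp : (p : ℝ) < 1) (hlaw : ∀ i, HasLaw (X i) (stepLaw p) P) (i : ℕ) :
    ∫ ω, X i ω ∂P = 0 := by
  rw [(hlaw i).integral_eq, integral_id_stepLaw hp]

theorem variance_of_hasLaw (hp : (p : ℝ) < 1) (hlaw : ∀ i, HasLaw (X i) (stepLaw p) P) (i : ℕ) :
    Var[X i; P] = 2 * (p / (1 - p)) := by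
  rw [variance_of_integral_eq_zero (hlaw i).aemeasurable (integral_of_hasLaw hp hlaw i),
    ← integral_sq_stepLaw hp, ← (hlaw i).integral_comp (f := fun x => x ^ 2) (by fun_prop)]
  rfl

variable [IsProbabilityMeasure P]

/-- The recursion for `walkAbs` peels off the first step, whereas the sum grows at its last index.
Since the steps are independent with the same law, `X k` may play the part of the first step, and
Fubini applies. -/
theorem walkAbs_eq_integral (hp : (p : ℝ) < 1) (hmeas : ∀ i, Measurable (X i))
    (hlaw : ∀ i, HasLaw (X i) (stepLaw p) P) (hindep : iIndepFun X P) (k : ℕ) (z : ℝ) :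
    walkAbs p k z = ∫ ω, |z + ∑ j ∈ Finset.range k, X j ω| ∂P := by
  have hint (i : ℕ) : Integrable (X i) P := (memLp_two_of_hasLaw hp hlaw i).integrable one_le_two
  induction k generalizing z with
  | zero => simp [walkAbs]
  | succ k ih =>
    have hS : Measurable fun ω => ∑ j ∈ Finset.range k, X j ω :=
      Finset.measurable_sum _ fun j _ => hmeas j
    have hind : IndepFun (X k) (fun ω => ∑ j ∈ Finset.range k, X j ω) P := by
      have := (hindep.indepFun_finsetSum_of_notMem hmeas (Finset.notMem_range_self (n := k))).symm
      convert this using 1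
      ext ω
      simp
    have hpair : Measurable fun ω => (X k ω, ∑ j ∈ Finset.range k, X j ω) := (hmeas k).prodMk hS
    have hmap := (indepFun_iff_map_prod_eq_prod_map_map (hmeas k).aemeasurable
      hS.aemeasurable).1 hind
    have hg : Measurable fun y : ℝ × ℝ => |z + (y.2 + y.1)| := by fun_prop
    have hgi : Integrable (fun y : ℝ × ℝ => |z + (y.2 + y.1)|)
        ((P.map (X k)).prod (P.map fun ω => ∑ j ∈ Finset.range k, X j ω)) := by
      rw [← hmap, integrable_map_measure hg.aestronglyMeasurable hpair.aemeasurable]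
      change Integrable (fun ω => |z + (∑ j ∈ Finset.range k, X j ω + X k ω)|) P
      exact ((integrable_const z).add ((integrable_finsetSum (Finset.range k) fun j _ => hint j).add
        (hint k))).abs
    have hstep : ∫ ω, |z + ∑ j ∈ Finset.range (k + 1), X j ω| ∂P =
        ∫ x, walkAbs p k (z + x) ∂stepLaw p := by
      simp_rw [Finset.sum_range_succ]
      have h1 := integral_map (μ := P) hpair.aemeasurable
        (f := fun y : ℝ × ℝ => |z + (y.2 + y.1)|) hg.aestronglyMeasurable
      rw [← h1, hmap, integral_prod _ hgi, (hlaw k).map_eq]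
      congr 1
      ext x
      rw [ih, integral_map hS.aemeasurable (by fun_prop)]
      congr 1
      ext ω
      congr 1
      ring
    have hcont : Continuous fun x => walkAbs p k (z + x) := by
      have : LipschitzWith 1 (walkAbs p k) :=
        LipschitzWith.of_dist_le_mul fun x y => by
          simpa [Real.dist_eq] using abs_walkAbs_sub_le hp k x y
      exact this.continuous.comp (by fun_prop)
    rw [hstep, integral_stepLaw hcont.stronglyMeasurable
      (integrable_crossLaw_shift hp (abs_walkAbs_sub_le hp k) z)]
    rfl

/-- The first absolute moment of the free walk, by the central limit theorem. -/
theorem tendsto_walkAbs_div_sqrt (hp : (p : ℝ) < 1) (hp0 : (p : ℝ) ≠ 0) :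
    Tendsto (fun k : ℕ => (√(k : ℝ))⁻¹ * walkAbs p k 0) atTop
      (𝓝 (2 / √Real.pi * √((p : ℝ) / (1 - p)))) := by
  obtain ⟨Ω, _, P, X, hmeas, hlaw, hindep, _⟩ := exists_iid ℕ (stepLaw p)
  have hq := one_sub_pos hp
  have hpos : 0 < (p : ℝ) := lt_of_le_of_ne p.2.1 (Ne.symm hp0)
  have hθ : 0 < (p : ℝ) / (1 - p) := by positivity
  have hvar := variance_of_hasLaw hp hlaw 0
  have hmem := memLp_two_of_hasLaw hp hlaw
  have hclt := tendstoInDistribution_inv_sqrt_mul_sum_sub (P := P) (X := X)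
    (P' := gaussianReal 0 Var[X 0; P].toNNReal) (Y := id) HasLaw.id (hmem 0) hindep
    fun i => (hlaw i).identDistrib (hlaw 0)
  rw [integral_of_hasLaw hp hlaw] at hclt
  simp only [mul_zero, sub_zero] at hclt
  have hSm (n : ℕ) : Measurable fun ω => (√(n : ℝ))⁻¹ * ∑ k ∈ Finset.range n, X k ω :=
    (Finset.measurable_sum _ fun j _ => hmeas j).const_mul _
  have hSL (n : ℕ) : MemLp (fun ω => (√(n : ℝ))⁻¹ * ∑ k ∈ Finset.range n, X k ω) 2 P :=
    (memLp_finsetSum _ fun j _ => hmem j).const_mul _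
  -- An equality for `n ≥ 1`; only an inequality at `n = 0`, where the normalisation is `0`.
  have hSv (n : ℕ) : ∫ ω, ((√(n : ℝ))⁻¹ * ∑ k ∈ Finset.range n, X k ω) ^ 2 ∂P ≤
      2 * (p / (1 - p)) := by
    have h1 : Var[∑ k ∈ Finset.range n, X k; P] = n * (2 * (p / (1 - p))) := by
      rw [IndepFun.variance_sum (fun i _ => hmem i) fun i _ j _ hij => hindep.indepFun hij]
      simp [variance_of_hasLaw hp hlaw]
    have h2 : ∫ ω, (∑ k ∈ Finset.range n, X k) ω ∂P = 0 := by
      simp only [Finset.sum_apply]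
      rw [integral_finsetSum _ fun i _ => (hmem i).integrable one_le_two]
      simp [integral_of_hasLaw hp hlaw]
    rw [variance_of_integral_eq_zero (by fun_prop) h2] at h1
    simp only [Finset.sum_apply] at h1
    simp_rw [mul_pow]
    rw [integral_const_mul, h1, inv_pow, Real.sq_sqrt (by positivity), ← mul_assoc]
    refine mul_le_of_le_one_left (by positivity) ?_
    exact inv_mul_le_one
  have hG : MemLp id 2 (gaussianReal 0 Var[X 0; P].toNNReal) := memLp_id_gaussianReal 2
  have hGv : ∫ x, x ^ 2 ∂gaussianReal 0 Var[X 0; P].toNNReal = 2 * (p / (1 - p)) := by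
    have h1 : Var[id; gaussianReal 0 Var[X 0; P].toNNReal] = _ := variance_id_gaussianReal
    rw [variance_of_integral_eq_zero (by fun_prop) (by simp [integral_id_gaussianReal])] at h1
    simp only [id] at h1
    rw [h1, Real.coe_toNNReal _ (variance_nonneg _ _), hvar]
  have key := tendsto_integral_abs_of_tendsto hclt.tendsto (B := 2 * (p / (1 - p))) ?_ ?_ ?_ ?_
  · convert key using 1
    · ext n
      simp only [ProbabilityMeasure.coe_mk]
      rw [integral_map (hSm n).aemeasurable (by fun_prop), walkAbs_eq_integral hp hmeas hlaw hindep,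
        ← integral_const_mul]
      congr 1
      ext ω
      rw [abs_mul, abs_of_nonneg (inv_nonneg.2 (Real.sqrt_nonneg _)), zero_add]
    · simp only [ProbabilityMeasure.coe_mk, Measure.map_id]
      rw [integral_abs_gaussianReal (by rw [hvar]; simpa using hθ), hvar,
        Real.coe_toNNReal _ (by positivity)]
      congr 1
      generalize (p : ℝ) / (1 - p) = θ at hθ
      rw [show 2 * (2 * θ) / Real.pi = 2 ^ 2 * θ / Real.pi by ring, Real.sqrt_div (by positivity),
        Real.sqrt_mul (by positivity), Real.sqrt_sq two_pos.le]
      ring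
  · intro n
    simp only [ProbabilityMeasure.coe_mk]
    rw [integrable_map_measure (by fun_prop) (hSm n).aemeasurable]
    exact (hSL n).integrable_sq
  · intro n
    simp only [ProbabilityMeasure.coe_mk]
    rw [integral_map (hSm n).aemeasurable (by fun_prop)]
    exact hSv n
  · simp only [ProbabilityMeasure.coe_mk, Measure.map_id]
    exact hG.integrable_sq
  · simp only [ProbabilityMeasure.coe_mk, Measure.map_id]
    exact hGv.le

end StepLaw

/-! ### Asymptotics of the total displacement -/

theorem sum_sqrt_le (n : ℕ) : ∑ k ∈ Finset.range n, √(k : ℝ) ≤ 2 / 3 * (n * √n) := by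
  induction n with
  | zero => simp
  | succ n ih =>
    have hs := Real.sq_sqrt (Nat.cast_nonneg (α := ℝ) n)
    have ht := Real.sq_sqrt (Nat.cast_nonneg (α := ℝ) (n + 1))
    have hs0 := Real.sqrt_nonneg (n : ℝ)
    have ht0 := Real.sqrt_nonneg ((n + 1 : ℕ) : ℝ)
    rw [Finset.sum_range_succ]
    generalize √(n : ℝ) = s at *
    generalize √((n + 1 : ℕ) : ℝ) = t at *
    have h1 : t ^ 2 = s ^ 2 + 1 := by rw [hs, ht]; push_cast; ring
    rw [← hs] at ih
    rw [← ht]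
    -- With `t² = s² + 1`, the increment inequality is `2t³ - 3st² + s³ = (t - s)² (2t + s) ≥ 0`.
    nlinarith [mul_nonneg (sq_nonneg (t - s)) (by positivity : 0 ≤ 2 * t + s)]

theorem le_sum_sqrt_add (n : ℕ) :
    2 / 3 * (n * √n) ≤ ∑ k ∈ Finset.range n, √(k : ℝ) + √n := by
  induction n with
  | zero => simp
  | succ n ih =>
    have hs := Real.sq_sqrt (Nat.cast_nonneg (α := ℝ) n)
    have ht := Real.sq_sqrt (Nat.cast_nonneg (α := ℝ) (n + 1))
    have hs0 := Real.sqrt_nonneg (n : ℝ)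
    have ht0 := Real.sqrt_nonneg ((n + 1 : ℕ) : ℝ)
    rw [Finset.sum_range_succ]
    generalize √(n : ℝ) = s at *
    generalize √((n + 1 : ℕ) : ℝ) = t at *
    have h1 : t ^ 2 = s ^ 2 + 1 := by rw [hs, ht]; push_cast; ring
    rw [← hs] at ih
    rw [← ht]
    -- Here the increment inequality is `t³ - 3ts² + 2s³ = (t - s)² (t + 2s) ≥ 0`.
    nlinarith [mul_nonneg (sq_nonneg (t - s)) (by positivity : 0 ≤ t + 2 * s)]

theorem tendsto_sqrt_natCast_atTop : Tendsto (fun n : ℕ => √(n : ℝ)) atTop atTop :=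
  Real.tendsto_sqrt_atTop.comp tendsto_natCast_atTop_atTop

theorem tendsto_inv_natCast : Tendsto (fun n : ℕ => (n : ℝ)⁻¹) atTop (𝓝 0) :=
  tendsto_inv_atTop_zero.comp tendsto_natCast_atTop_atTop

theorem tendsto_sum_sqrt_div :
    Tendsto (fun n : ℕ => (∑ k ∈ Finset.range n, √(k : ℝ)) / (n * √n)) atTop (𝓝 (2 / 3)) := by
  have h1 : Tendsto (fun n : ℕ => 2 / 3 - (n : ℝ)⁻¹) atTop (𝓝 (2 / 3)) := by
    simpa using tendsto_const_nhds.sub tendsto_inv_natCast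
  refine tendsto_of_tendsto_of_tendsto_of_le_of_le' h1 tendsto_const_nhds ?_ ?_
  · filter_upwards [eventually_ge_atTop 1] with n hn
    have hn0 : (0 : ℝ) < n := by exact_mod_cast hn
    have hs0 := Real.sqrt_pos.2 hn0
    rw [le_div_iff₀ (by positivity), sub_mul, inv_mul_cancel_left₀ hn0.ne']
    linarith [le_sum_sqrt_add n]
  · filter_upwards [eventually_ge_atTop 1] with n hn
    have hn0 : (0 : ℝ) < n := by exact_mod_cast hn
    have hs0 := Real.sqrt_pos.2 hn0
    rw [div_le_iff₀ (by positivity)]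
    exact sum_sqrt_le n

theorem tendsto_sum_sqrt_atTop :
    Tendsto (fun n : ℕ => ∑ k ∈ Finset.range n, √(k : ℝ)) atTop atTop := by
  have h1 := tendsto_sum_sqrt_div.pos_mul_atTop (by norm_num : (0 : ℝ) < 2 / 3)
    (tendsto_natCast_atTop_atTop.atTop_mul_atTop₀ tendsto_sqrt_natCast_atTop)
  refine h1.congr' ?_
  filter_upwards [eventually_ge_atTop 1] with n hn
  have hn0 : (0 : ℝ) < n := by exact_mod_cast hn
  have hs0 := Real.sqrt_pos.2 hn0
  field_simp

/-- A Cesàro argument: as the sums of `√k` diverge, an error `o(√k)` in the terms remains negligible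
after summation. -/
theorem tendsto_sum_div_of_tendsto_inv_sqrt_mul {u : ℕ → ℝ} {a : ℝ}
    (h : Tendsto (fun k : ℕ => (√(k : ℝ))⁻¹ * u k) atTop (𝓝 a)) :
    Tendsto (fun n : ℕ => (∑ k ∈ Finset.range n, u k) / (n * √n)) atTop (𝓝 (2 / 3 * a)) := by
  have h1 : (fun k : ℕ => u k - a * √(k : ℝ)) =o[atTop] fun k : ℕ => √(k : ℝ) := by
    have hne : ∀ᶠ k : ℕ in atTop, √(k : ℝ) ≠ 0 := by
      filter_upwards [eventually_ge_atTop 1] with n hn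
      exact (Real.sqrt_pos.2 (by exact_mod_cast hn)).ne'
    rw [Asymptotics.isLittleO_iff_tendsto' (hne.mono fun k hk h0 => absurd h0 hk)]
    rw [← sub_self a]
    refine (h.sub_const a).congr' ?_
    filter_upwards [hne] with k hk
    field_simp
  have h2 := (h1.sum_range (fun k => Real.sqrt_nonneg _)
    tendsto_sum_sqrt_atTop).tendsto_div_nhds_zero
  have h3 := (h2.mul tendsto_sum_sqrt_div).add (tendsto_sum_sqrt_div.mul_const a)
  rw [zero_mul, zero_add] at h3
  refine h3.congr' ?_
  filter_upwards [tendsto_sum_sqrt_atTop.eventually_gt_atTop 0] with n hn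
  rw [Finset.sum_sub_distrib, ← Finset.mul_sum]
  field_simp
  ring

/-- The wall error `O(n)` vanishes after division by `n√n`, so the free walks alone determine the
limit. -/
theorem tendsto_integral_displacement_div {p : I} (hp : (p : ℝ) < 1) :
    Tendsto (fun n : ℕ => (∫ D, (displacement (perm D) : ℝ) ∂law p n) / (n * √n)) atTop
      (𝓝 (4 / (3 * √Real.pi) * √((p : ℝ) / (1 - p)))) := by
  rcases eq_or_ne (p : ℝ) 0 with h0 | h0
  · simp [integral_displacement_of_eq_zero h0, h0]
  have h1 := tendsto_sum_div_of_tendsto_inv_sqrt_mul (tendsto_walkAbs_div_sqrt hp h0)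
  have hc : 2 / 3 * (2 / √Real.pi * √((p : ℝ) / (1 - p))) =
      4 / (3 * √Real.pi) * √((p : ℝ) / (1 - p)) := by
    field_simp
    ring
  rw [hc] at h1
  obtain ⟨K, hK⟩ : ∃ K : ℝ, K = p / (1 - p) + 4 * Real.exp (2 * (p / (1 - p))) := ⟨_, rfl⟩
  have h2 : Tendsto (fun n : ℕ => K * (√(n : ℝ))⁻¹) atTop (𝓝 0) := by
    simpa using (tendsto_inv_atTop_zero.comp tendsto_sqrt_natCast_atTop).const_mul K
  have h3 : Tendsto (fun n : ℕ => (∫ D, (displacement (perm D) : ℝ) ∂law p n -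
      ∑ k ∈ Finset.range n, walkAbs p k 0) / (n * √n)) atTop (𝓝 0) := by
    refine squeeze_zero_norm' ?_ h2
    filter_upwards [eventually_ge_atTop 1,
      tendsto_sqrt_natCast_atTop.eventually_ge_atTop (2 * ((p : ℝ) / (1 - p)))] with n hn hpn
    have hn0 : (0 : ℝ) < n := by exact_mod_cast hn
    have hs0 := Real.sqrt_pos.2 hn0
    have h4 := abs_integral_displacement_sub_le hp hn hpn
    rw [← hK] at h4
    rw [norm_div, Real.norm_eq_abs, Real.norm_of_nonneg (by positivity),
      div_le_iff₀ (by positivity)]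
    refine h4.trans_eq ?_
    field_simp
  refine (by simpa using h3.add h1 : Tendsto _ _ _).congr fun n => ?_
  ring

/-! ### Convergence to the identity permuton -/

/-- Permutons whose mean distance to the diagonal tends to `0` tend to the identity permuton. -/
theorem comap_integral_dist_le_nhds_idPermuton :
    comap (fun μ : Permuton => ∫ z, dist z.1 z.2 ∂(μ.1 : Measure (I × I))) (𝓝 0) ≤
      𝓝 idPermuton := by
  obtain ⟨F, hF⟩ : ∃ F, F =
    comap (fun μ : Permuton => ∫ z, dist z.1 z.2 ∂(μ.1 : Measure (I × I))) (𝓝 0) := ⟨_, rfl⟩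
  have hF0 : Tendsto (fun μ : Permuton => ∫ z, dist z.1 z.2 ∂(μ.1 : Measure (I × I))) F (𝓝 0) := by
    rw [hF]
    exact tendsto_comap
  rw [← hF]
  change Tendsto id F (𝓝 idPermuton)
  refine tendsto_subtype_rng.2 ?_
  rw [ProbabilityMeasure.tendsto_iff_forall_integral_tendsto]
  intro g
  have hid : ∫ z, g z ∂(idPermuton.1 : Measure (I × I)) = ∫ x : I, g (x, x) := by
    change ∫ z, g z ∂((volume : Measure I).map (fun x => (x, x))) = _
    rw [integral_map (by fun_prop) g.continuous.stronglyMeasurable.aestronglyMeasurable]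
  -- The uniform first marginal turns the target into an integral against `μ` itself, so that only
  -- `g z - g (z.1, z.1)` has to be controlled.
  have hfst (μ : Permuton) : ∫ x : I, g (x, x) =
      ∫ z, g (z.1, z.1) ∂(μ.1 : Measure (I × I)) := by
    have hc : Continuous fun x : I => g (x, x) := by fun_prop
    exact (congrArg (fun ν => ∫ x, g (x, x) ∂ν) μ.2.1).symm.trans
      (integral_map (by fun_prop) hc.stronglyMeasurable.aestronglyMeasurable)
  rw [hid, Metric.tendsto_nhds]
  intro ε hε
  obtain ⟨δ, hδ, hgδ⟩ := Metric.uniformContinuous_iff.1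
    (CompactSpace.uniformContinuous_of_continuous g.continuous) (ε / 2) (by positivity)
  have hlim : Tendsto (fun μ : Permuton => ε / 2 + 2 * ‖g‖ / δ *
      ∫ z, dist z.1 z.2 ∂(μ.1 : Measure (I × I))) F (𝓝 (ε / 2)) := by
    simpa using (hF0.const_mul (2 * ‖g‖ / δ)).const_add (ε / 2)
  filter_upwards [hlim.eventually_lt_const (by linarith : ε / 2 < ε)] with μ hμ
  refine lt_of_le_of_lt ?_ hμ
  have hd : Integrable (fun z : I × I => dist z.1 z.2) (μ.1 : Measure (I × I)) := by
    refine Integrable.of_bound (by fun_prop : Continuous _).aestronglyMeasurable 1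
      (ae_of_all _ fun z => ?_)
    rw [Real.norm_of_nonneg dist_nonneg]
    exact Real.dist_le_of_mem_Icc_01 z.1.2 z.2.2
  have hi1 : Integrable g (μ.1 : Measure (I × I)) := g.integrable _
  have hi2 : Integrable (fun z : I × I => g (z.1, z.1)) (μ.1 : Measure (I × I)) :=
    (g.compContinuous ⟨fun z : I × I => (z.1, z.1), by fun_prop⟩).integrable _
  rw [Real.dist_eq, hfst μ, id, ← integral_sub hi1 hi2, ← integral_const_mul]
  have hconst : ε / 2 = ∫ _, ε / 2 ∂(μ.1 : Measure (I × I)) := by simp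
  rw [hconst, ← integral_add (integrable_const _) (hd.const_mul _)]
  refine abs_integral_le_integral_abs.trans (integral_mono (hi1.sub hi2).abs
    ((integrable_const _).add (hd.const_mul _)) fun z => ?_)
  change |g z - g (z.1, z.1)| ≤ ε / 2 + 2 * ‖g‖ / δ * dist z.1 z.2
  -- Uniform continuity near the diagonal, Markov's inequality away from it.
  rcases lt_or_ge (dist z.1 z.2) δ with h | h
  · have h1 : dist z (z.1, z.1) < δ := by
      rw [Prod.dist_eq, dist_self, dist_comm z.2]
      exact max_lt hδ h
    have h2 := hgδ h1
    rw [Real.dist_eq] at h2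
    have : 0 ≤ 2 * ‖g‖ / δ * dist z.1 z.2 := by positivity
    linarith
  · have h1 : |g z - g (z.1, z.1)| ≤ 2 * ‖g‖ := by
      rw [← Real.dist_eq]
      exact g.dist_le_two_norm _ _
    have h2 : 2 * ‖g‖ ≤ 2 * ‖g‖ / δ * dist z.1 z.2 := by
      rw [div_mul_eq_mul_div, le_div_iff₀ hδ]
      gcongr
    linarith

theorem dist_le_of_mem_cell {n : ℕ} {i j : Fin n} {x y : I} (hx : x ∈ cell i) (hy : y ∈ cell j) :
    dist x y ≤ (|(j : ℝ) - i| + 1) / n := by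
  have h1 : (x : ℝ) - y ≤ (|(j : ℝ) - i| + 1) / n := by
    calc (x : ℝ) - y ≤ ((i : ℝ) + 1) / n - j / n := by linarith [hx.2, hy.1]
      _ = ((i - j : ℝ) + 1) / n := by ring
      _ ≤ _ := by
        gcongr
        rw [abs_sub_comm]
        exact le_abs_self _
  have h2 : (y : ℝ) - x ≤ (|(j : ℝ) - i| + 1) / n := by
    calc (y : ℝ) - x ≤ ((j : ℝ) + 1) / n - i / n := by linarith [hy.2, hx.1]
      _ = ((j - i : ℝ) + 1) / n := by ring
      _ ≤ _ := by
        gcongr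
        exact le_abs_self _
  rw [Subtype.dist_eq, Real.dist_eq, abs_le]
  constructor <;> linarith

/-- Each of the `n` squares has mass `1/n`, and in square `i` the distance is at most `(|w i - i| +
1) / n`; the summand `1`, due to the width of the cells, produces the extra `n`. -/
theorem integral_dist_permMeasure_le {n : ℕ} [NeZero n] (w : Equiv.Perm (Fin n)) :
    ∫ z, dist z.1 z.2 ∂permMeasure w ≤ (displacement w + n) / (n : ℝ) ^ 2 := by
  have hn : (0 : ℝ) < n := by exact_mod_cast Nat.pos_of_ne_zero (NeZero.ne n)
  have hvol (i : Fin n) : (volume : Measure (I × I)) (cell i ×ˢ cell (w i)) =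
      (n : ℝ≥0∞)⁻¹ * (n : ℝ≥0∞)⁻¹ := by
    rw [Measure.volume_eq_prod, Measure.prod_prod, volume_cell, volume_cell]
  have hd (μ : Measure (I × I)) [IsFiniteMeasure μ] :
      Integrable (fun z : I × I => dist z.1 z.2) μ := by
    refine Integrable.of_bound (by fun_prop : Continuous _).aestronglyMeasurable 1
      (ae_of_all _ fun z => ?_)
    rw [Real.norm_of_nonneg dist_nonneg]
    exact Real.dist_le_of_mem_Icc_01 z.1.2 z.2.2
  have hterm (i : Fin n) : ∫ z in cell i ×ˢ cell (w i), dist z.1 z.2 ≤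
      (|((w i : ℕ) : ℝ) - i| + 1) / n * ((n : ℝ)⁻¹ * (n : ℝ)⁻¹) := by
    refine (Real.le_norm_self _).trans ((norm_setIntegral_le_of_norm_le_const
      (f := fun z : I × I => dist z.1 z.2) (C := (|((w i : ℕ) : ℝ) - i| + 1) / n)
      (measure_lt_top _ _) fun z hz => ?_).trans_eq ?_)
    · rw [Real.norm_of_nonneg dist_nonneg]
      exact dist_le_of_mem_cell hz.1 hz.2
    · rw [measureReal_def, hvol]
      simp
  rw [permMeasure, integral_finsetSum_measure fun i _ =>
    (hd _).smul_measure (ENNReal.natCast_ne_top n)]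
  have hD : (displacement w : ℝ) + n = ∑ i : Fin n, (|((w i : ℕ) : ℝ) - i| + 1) := by
    rw [Finset.sum_add_distrib]
    simp [displacement, Nat.cast_natAbs]
  rw [hD, Finset.sum_div]
  refine Finset.sum_le_sum fun i _ => ?_
  rw [integral_smul_measure, ENNReal.toReal_natCast, smul_eq_mul]
  calc (n : ℝ) * ∫ z in cell i ×ˢ cell (w i), dist z.1 z.2
      ≤ n * ((|((w i : ℕ) : ℝ) - i| + 1) / n * ((n : ℝ)⁻¹ * (n : ℝ)⁻¹)) := by
        gcongr
        exact hterm i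
    _ = _ := by field_simp

theorem tendsto_integral_displacement_add_div_sq {p : I} (hp : (p : ℝ) < 1) :
    Tendsto (fun n : ℕ => ((∫ D, (displacement (perm D) : ℝ) ∂law p n) + n) / (n : ℝ) ^ 2) atTop
      (𝓝 0) := by
  have h1 := ((tendsto_integral_displacement_div hp).mul
    (tendsto_inv_atTop_zero.comp tendsto_sqrt_natCast_atTop)).add tendsto_inv_natCast
  rw [mul_zero, add_zero] at h1
  refine h1.congr' ?_
  filter_upwards [eventually_ge_atTop 1] with n hn
  have hn0 : (0 : ℝ) < n := by exact_mod_cast hn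
  have hs0 := Real.sqrt_pos.2 hn0
  have hs := Real.mul_self_sqrt hn0.le
  simp only [Function.comp]
  rw [div_mul_eq_mul_div, ← div_eq_mul_inv, div_div, mul_left_comm, hs, add_div, ← sq]
  congr 1
  field_simp

theorem tendstoInDistribution_permutonOf {p : I} (hp : (p : ℝ) < 1) :
    TendstoInDistribution
      (fun (n : ℕ) (D : PipeDream (n + 1)) => permutonOf (perm D))
      atTop (fun _ : Unit => idPermuton) (fun n : ℕ => law p (n + 1)) (Measure.dirac ()) where
  forall_aemeasurable n := (measurable_of_finite _).aemeasurable
  tendsto := by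
    refine ProbabilityMeasure.tendsto_iff_forall_integral_tendsto.2 fun f => ?_
    have hfm : StronglyMeasurable f := f.continuous.stronglyMeasurable
    simp only [ProbabilityMeasure.coe_mk]
    rw [integral_map (by fun_prop) hfm.aestronglyMeasurable, integral_dirac, Metric.tendsto_atTop']
    intro ε hε
    have hnhds : {μ | dist (f μ) (f idPermuton) < ε / 2} ∈ 𝓝 idPermuton :=
      f.continuous.continuousAt (Metric.ball_mem_nhds _ (half_pos hε))
    -- This provides a `δ` such that every permuton with mean distance to the diagonal below `δ` has
    -- `f` within `ε / 2` of its value at the identity permuton.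
    obtain ⟨s, hs, hsf⟩ := mem_comap.1 (comap_integral_dist_le_nhds_idPermuton hnhds)
    obtain ⟨δ, hδ, hδs⟩ := Metric.mem_nhds_iff.1 hs
    have hlim := (((tendsto_integral_displacement_add_div_sq hp).comp
      (tendsto_add_atTop_nat 1)).const_mul (2 * ‖f‖ / δ)).const_add (ε / 2)
    rw [mul_zero, add_zero] at hlim
    obtain ⟨N, hN⟩ := eventually_atTop.1 (hlim.eventually_lt_const (half_lt_self hε))
    refine ⟨N, fun n hn => lt_of_le_of_lt ?_ (hN n hn.le)⟩
    rw [integral_map (measurable_of_finite _).aemeasurable hfm.aestronglyMeasurable, Real.dist_eq]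
    have hconst : f idPermuton = ∫ _, f idPermuton ∂law p (n + 1) := by simp
    rw [hconst, ← integral_sub (integrable_law p _) (integrable_law p _)]
    refine (abs_integral_le_integral_abs.trans (integral_mono (integrable_law p _)
      (integrable_law p fun D => ε / 2 + 2 * ‖f‖ / δ *
        (((displacement (perm D) : ℝ) + (n + 1 : ℕ)) / ((n + 1 : ℕ) : ℝ) ^ 2)) fun D => ?_)).trans_eq
      ?_
    · have hm := integral_dist_permMeasure_le (perm D)
      have hm0 : 0 ≤ ∫ z, dist z.1 z.2 ∂permMeasure (perm D) :=
        integral_nonneg fun z => dist_nonneg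
      -- Markov's inequality in pointwise form: if the mean distance is at least `δ`, the trivial
      -- bound `2 * ‖f‖` is at most its multiple by mean distance over `δ`.
      rcases lt_or_ge (∫ z, dist z.1 z.2 ∂permMeasure (perm D)) δ with h | h
      · have h1 : permutonOf (perm D) ∈ {μ | dist (f μ) (f idPermuton) < ε / 2} := by
          refine hsf (hδs ?_)
          change (∫ z, dist z.1 z.2 ∂permMeasure (perm D)) ∈ Metric.ball 0 δ
          rw [mem_ball_zero_iff, Real.norm_of_nonneg hm0]
          exact h
        have h2 : |f (permutonOf (perm D)) - f idPermuton| < ε / 2 := by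
          rw [← Real.dist_eq]
          exact h1
        have h3 : 0 ≤ 2 * ‖f‖ / δ *
          (((displacement (perm D) : ℝ) + (n + 1 : ℕ)) / ((n + 1 : ℕ) : ℝ) ^ 2) := by positivity
        linarith
      · have h1 : |f (permutonOf (perm D)) - f idPermuton| ≤ 2 * ‖f‖ := by
          rw [← Real.dist_eq]
          exact f.dist_le_two_norm _ _
        have h2 : 2 * ‖f‖ ≤ 2 * ‖f‖ / δ *
            (((displacement (perm D) : ℝ) + (n + 1 : ℕ)) / ((n + 1 : ℕ) : ℝ) ^ 2) := by
          rw [div_mul_eq_mul_div, le_div_iff₀ hδ]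
          have := h.trans hm
          gcongr
        linarith
    · rw [integral_add (integrable_law p _) (integrable_law p _), integral_const_mul,
        integral_div (((n + 1 : ℕ) : ℝ) ^ 2),
        integral_add (integrable_law p _) (integrable_law p _)]
      simp

/-! ### Inversions -/

theorem integral_inv_le (p : I) (n : ℕ) : ∫ D, (inv (perm D) : ℝ) ∂law p n ≤
    ∫ D, (displacement (perm D) : ℝ) ∂law p n :=
  integral_mono (integrable_law p _) (integrable_law p _) fun D => by
    dsimp only
    exact_mod_cast inv_le_displacement (perm D)

theorem integral_displacement_le (p : I) (n : ℕ) : ∫ D, (displacement (perm D) : ℝ) ∂law p n ≤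
    2 * ∫ D, (inv (perm D) : ℝ) ∂law p n := by
  rw [← integral_const_mul]
  exact integral_mono (integrable_law p _) (integrable_law p _) fun D => by
    dsimp only
    exact_mod_cast displacement_le_two_mul_inv (perm D)

theorem rpow_three_halves {x : ℝ} (hx : 0 ≤ x) : x ^ (3 / 2 : ℝ) = x * √x := by
  rw [Real.sqrt_eq_rpow, show (3 / 2 : ℝ) = 1 + 1 / 2 by norm_num,
    Real.rpow_add_of_nonneg hx zero_le_one (by norm_num), Real.rpow_one]

theorem eventually_integral_inv_bounds {p : I} (hp : (p : ℝ) < 1) {ε : ℝ} (hε : 0 < ε) :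
    ∀ᶠ n : ℕ in atTop,
      2 / (3 * √Real.pi) * (1 - ε) * (n : ℝ) ^ (3 / 2 : ℝ) * √((p : ℝ) / (1 - p)) ≤
          ∫ D, (inv (perm D) : ℝ) ∂law p n ∧
        ∫ D, (inv (perm D) : ℝ) ∂law p n ≤
          4 / (3 * √Real.pi) * (1 + ε) * (n : ℝ) ^ (3 / 2 : ℝ) * √((p : ℝ) / (1 - p)) := by
  -- For `p = 0` the limit constant vanishes and convergence gives no multiplicative bounds; there
  -- the displacement has mean exactly `0`.
  rcases eq_or_ne (p : ℝ) 0 with h0 | h0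
  · refine Eventually.of_forall fun n => ?_
    have h1 := integral_inv_le p n
    have h2 := integral_displacement_le p n
    rw [integral_displacement_of_eq_zero h0] at h1 h2
    simp only [h0, zero_div, Real.sqrt_zero, mul_zero]
    constructor <;> linarith
  · have hq := one_sub_pos hp
    have hpos : 0 < (p : ℝ) := lt_of_le_of_ne p.2.1 (Ne.symm h0)
    obtain ⟨A, hA⟩ : ∃ A, A = 4 / (3 * √Real.pi) * √((p : ℝ) / (1 - p)) := ⟨_, rfl⟩
    have hA0 : 0 < A := by rw [hA]; positivity
    have hlim := tendsto_integral_displacement_div hp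
    rw [← hA] at hlim
    filter_upwards [hlim.eventually_const_lt (by nlinarith : A * (1 - ε) < A),
      hlim.eventually_lt_const (by nlinarith : A < A * (1 + ε)), eventually_ge_atTop 1]
      with n hl hu hn
    have hn0 : (0 : ℝ) < n := by exact_mod_cast hn
    have hs0 := Real.sqrt_pos.2 hn0
    rw [lt_div_iff₀ (by positivity)] at hl
    rw [div_lt_iff₀ (by positivity)] at hu
    have h1 := integral_inv_le p n
    have h2 := integral_displacement_le p n
    rw [rpow_three_halves hn0.le]
    constructor
    · have : 2 / (3 * √Real.pi) * (1 - ε) * (n * √n) * √((p : ℝ) / (1 - p)) =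
          A * (1 - ε) * (n * √n) / 2 := by rw [hA]; ring
      linarith
    · have : 4 / (3 * √Real.pi) * (1 + ε) * (n * √n) * √((p : ℝ) / (1 - p)) =
          A * (1 + ε) * (n * √n) := by rw [hA]; ring
      linarith

end RandomPipeDream

theorem theorem1p6 (p : I) (hp : (p : ℝ) < 1) :
    (∀ ε : ℝ, 0 < ε → ∀ᶠ n : ℕ in atTop,
      2 / (3 * √Real.pi) * (1 - ε) * (n : ℝ) ^ (3 / 2 : ℝ) * √((p : ℝ) / (1 - p)) ≤
          ∫ D, (RandomPipeDream.inv (RandomPipeDream.perm D) : ℝ) ∂(RandomPipeDream.law p n) ∧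
        ∫ D, (RandomPipeDream.inv (RandomPipeDream.perm D) : ℝ) ∂(RandomPipeDream.law p n) ≤
          4 / (3 * √Real.pi) * (1 + ε) * (n : ℝ) ^ (3 / 2 : ℝ) * √((p : ℝ) / (1 - p))) ∧
    TendstoInDistribution
      (fun (n : ℕ) (D : RandomPipeDream.PipeDream (n + 1)) =>
        RandomPipeDream.permutonOf (RandomPipeDream.perm D))
      atTop
      (fun _ : Unit => RandomPipeDream.idPermuton)
      (fun n : ℕ => RandomPipeDream.law p (n + 1))
      (Measure.dirac ()) :=
  ⟨fun _ hε => RandomPipeDream.eventually_integral_inv_bounds hp hε,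
    RandomPipeDream.tendstoInDistribution_permutonOf hp⟩
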